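/- Let $\varepsilon>0$ and set $\delta=\varepsilon/4$ and $t_\delta=(2(1+\delta)\delta)^{-1/(2\delta)}$. There are a smooth function $\sigma:(0,\infty)\to(0,\infty)$ with $\sigma(t)=t$ for $0<t<\tfrac14$ and $\sigma(t)=t^{-(1+\delta)}e^{-t^{2+2\delta}}$ for $t>t_\delta$, and a smooth Riemannian metric $g$ on $M=\mathbb R^2$ (the model manifold $\mathbb R_+\times_\sigma\mathbb S^1$ with its pole $o=0$ included) which in polar coordinates $(t,\theta)$ on $\mathbb R^2\setminus\{0\}$ is $g=dt^2+\sigma(t)^2\,d\theta^2$, such that the following hold. 1. The Riemannian distance $r(x)=d_g(o,x)$ from the pole equals $t=|x|$, and for some constant $C>0$ the Gaussian curvature satisfies $K(x)\sim -C\,r(x)^{2+\varepsilon}$ as $x\to\infty$, i.e. the quotient of the two sides tends to $1$. 2. The function $V(t,\theta)=-\bigl(e^{t^{2+2\delta}}-e^{t_\delta^{2+2\delta}}\bigr)_+$ belongs to $L^1(M,d\mu_g)$, where $\mu_g$ is the Riemannian measure, and satisfies $(-\Delta+1)V\ge0$ in the sense of distributions, i.e. $\int_M V(-\Delta\varphi+\varphi)\,d\mu_g\ge0$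 for all $0\le\varphi\in C_c^\infty(M)$, where $\Delta$ is the (negatively defined) Laplace–Beltrami operator; but it is not true that $V\ge0$ almost everywhere. 3. Consequently the $L^1$-positivity preserving property fails on $(M,g)$: it is not true that every $u\in L^1(M,d\mu_g)$ with $(-\Delta+1)u\ge0$ in the sense of distributions is non-negative almost everywhere. -/

import Mathlib

open MeasureTheory Set Filter Topology
open scoped ContDiff Manifold ENNReal

noncomputable section

namespace ModelSurface

/-- The plane `ℝ²`, the underlying smooth manifold of a rotationally symmetric
2-dimensional model manifold (the origin is the pole). -/
abbrev Plane : Type := EuclideanSpace ℝ (Fin 2)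

/-- The standard smooth structure of `ℝ²`: the identity is a global chart. -/
instance planeChartedSpace : ChartedSpace Plane Plane := chartedSpaceSelf Plane

/-- Smooth Riemannian metrics on the manifold `ℝ²`. -/
abbrev PlaneMetric : Type :=
  Bundle.ContMDiffRiemannianMetric 𝓘(ℝ, Plane) ∞ Plane
    (fun x : Plane => TangentSpace 𝓘(ℝ, Plane) x)

/-- The standard basis of `ℝ²`. -/
def stdVec (i : Fin 2) : Plane := EuclideanSpace.single i (1 : ℝ)

/-- The partial derivative `∂ᵢ f` at `x`. -/
def partialDeriv (i : Fin 2) (f : Plane → ℝ) (x : Plane) : ℝ := fderiv ℝ f x (stdVec i)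

/-- The inner product `g_x(v, w)` of two tangent vectors at `x`, written in the global chart. -/
def metricInner (g : PlaneMetric) (x v w : Plane) : ℝ := g.inner x v w

/-- The matrix `(g_{ij}(x))` of the metric in the standard coordinates. -/
def gram (g : PlaneMetric) (x : Plane) : Matrix (Fin 2) (Fin 2) ℝ :=
  Matrix.of fun i j => metricInner g x (stdVec i) (stdVec j)

/-- The density `√(det g)` of the Riemannian measure. -/
def volDensity (g : PlaneMetric) (x : Plane) : ℝ := Real.sqrt (gram g x).det

/-- The Riemannian measure `√(det g) dx`. -/
def riemannianMeasure (g : PlaneMetric) : Measure Plane :=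
  (volume : Measure Plane).withDensity fun x => ENNReal.ofReal (volDensity g x)

/-- The (negatively defined) Laplace-Beltrami operator
`Δ φ = (1 / √(det g)) ∑ᵢⱼ ∂ᵢ (√(det g) gⁱʲ ∂ⱼ φ)`. -/
def laplaceBeltrami (g : PlaneMetric) (φ : Plane → ℝ) (x : Plane) : ℝ :=
  (volDensity g x)⁻¹ * ∑ i, ∑ j,
    partialDeriv i (fun y => volDensity g y * (gram g y)⁻¹ i j * partialDeriv j φ y) x

/-- The Christoffel symbols `Γᵏᵢⱼ = ½ ∑ₗ gᵏˡ (∂ᵢ gⱼₗ + ∂ⱼ gᵢₗ - ∂ₗ gᵢⱼ)`. -/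
def christoffel (g : PlaneMetric) (k i j : Fin 2) (x : Plane) : ℝ :=
  (1 / 2 : ℝ) * ∑ l, (gram g x)⁻¹ k l *
    (partialDeriv i (fun y => gram g y j l) x + partialDeriv j (fun y => gram g y i l) x
      - partialDeriv l (fun y => gram g y i j) x)

/-- The components of the curvature tensor, `R(∂ᵢ, ∂ⱼ) ∂ₖ = ∑ₗ Rˡₖᵢⱼ ∂ₗ`, with
`R(X, Y) Z = ∇_X ∇_Y Z - ∇_Y ∇_X Z - ∇_[X,Y] Z`. -/
def curvatureTensor (g : PlaneMetric) (l k i j : Fin 2) (x : Plane) : ℝ :=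
  partialDeriv i (christoffel g l j k) x - partialDeriv j (christoffel g l i k) x
    + ∑ m, (christoffel g l i m x * christoffel g m j k x
      - christoffel g l j m x * christoffel g m i k x)

/-- The Gaussian curvature `K = g(R(∂₁, ∂₂) ∂₂, ∂₁) / det g`. -/
def gaussianCurvature (g : PlaneMetric) (x : Plane) : ℝ :=
  (∑ l, gram g x 0 l * curvatureTensor g l 1 0 1 x) / (gram g x).det

/-- The Riemannian distance: the infimum of the `g`-lengths of the `C¹` paths from `x` to `y`. -/
def riemannianDist (g : PlaneMetric) (x y : Plane) : ℝ≥0∞ :=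
  letI : ∀ z : Plane, ENorm (TangentSpace 𝓘(ℝ, Plane) z) := fun z =>
    ⟨fun v => ENNReal.ofReal (Real.sqrt (g.inner z v v))⟩
  Manifold.riemannianEDist 𝓘(ℝ, Plane) x y

/-- `u ∈ L¹_loc` solves `(-Δ + 1) u ≥ 0` in the sense of distributions:
`∫ u (-Δ + 1) φ ≥ 0` for all `0 ≤ φ ∈ C_c^∞`. -/
def DistribNonneg (g : PlaneMetric) (u : Plane → ℝ) : Prop :=
  LocallyIntegrable u (riemannianMeasure g) ∧
    ∀ φ : Plane → ℝ, ContDiff ℝ ∞ φ → HasCompactSupport φ → (∀ x, 0 ≤ φ x) →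
      0 ≤ ∫ x, u x * (-laplaceBeltrami g φ x + φ x) ∂(riemannianMeasure g)

/-- The `L^p`-positivity preserving property (for `1 ≤ p ≤ ∞`): every `u ∈ L^p` with
`(-Δ + 1) u ≥ 0` in the sense of distributions is non-negative a.e. -/
def PositivityPreserving (g : PlaneMetric) (p : ℝ≥0∞) : Prop :=
  ∀ u : Plane → ℝ, MemLp u p (riemannianMeasure g) → DistribNonneg g u →
    ∀ᵐ x ∂(riemannianMeasure g), 0 ≤ u x

/-- `g` is the metric of the model manifold `ℝ₊ ×_σ 𝕊¹`: the warping function `σ` is smooth and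
positive on `(0, ∞)`, and `g = dt² + σ(t)² dθ²` in the polar coordinates
`(t, θ) ↦ (t cos θ, t sin θ)`, whose coordinate fields are `∂_t = (cos θ, sin θ)` and
`∂_θ = (-t sin θ, t cos θ)`. -/
def IsModelMetric (g : PlaneMetric) (σ : ℝ → ℝ) : Prop :=
  ContDiffOn ℝ ∞ σ (Ioi 0) ∧ (∀ t, 0 < t → 0 < σ t) ∧
    ∀ t θ : ℝ, 0 < t →
      let x : Plane := !₂[t * Real.cos θ, t * Real.sin θ]
      let dt : Plane := !₂[Real.cos θ, Real.sin θ]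
      let dθ : Plane := !₂[-(t * Real.sin θ), t * Real.cos θ]
      metricInner g x dt dt = 1 ∧ metricInner g x dt dθ = 0 ∧ metricInner g x dθ dθ = σ t ^ 2

/-- The radius `t_δ = (2 (1 + δ) δ)^(-1 / (2 δ))`. -/
def radius (δ : ℝ) : ℝ := (2 * (1 + δ) * δ) ^ (-(1 / (2 * δ)))

/-- The function `V(t, θ) = -(e^(t^(2 + 2 δ)) - e^(t_δ^(2 + 2 δ)))₊`, where `t = ‖x‖` is the radial
polar coordinate. -/
def witness (δ : ℝ) (x : Plane) : ℝ :=
  -max (Real.exp (‖x‖ ^ (2 + 2 * δ)) - Real.exp (radius δ ^ (2 + 2 * δ))) 0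

end ModelSurface

end

/-! Write `ρ = t²` and `σ = t·e^L`. Since `t² dθ` is the polynomial form `x₀ dx₁ - x₁ dx₀`, the
metric `dt² + σ² dθ²` equals the Euclidean one plus `F(ρ) (t² dθ)²`, where `1 + ρF = (σ/t)² =
e^{2L}`. This is smooth across the pole as soon as `L` is smooth and vanishes near `0`. The
prescribed tail of `σ` is `L = -(1 + δ/2) log ρ - ρ^{1+δ}`, and a smooth cutoff joins it to `L = 0`;
there is room for this because `t_δ > 1/4` (`lt_radius_sq`). Rays from the pole are orthogonal to
the angular part, so `r = t`. The curvature is `-σ''/σ = -(6L' + 4ρL'² + 4ρL'')` with primes on `L`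
taken in `ρ`; the term `4ρL'²` dominates and gives `-4(1+δ)² t^{2+4δ}`, where `4δ = ε`.

For `u = e^{t^{2+2δ}} - e^{t_δ^{2+2δ}}` the growth of `u'` cancels the decay of `σ`: beyond `t_δ`
the flux `σu'` is `2(1+δ)t^δ`. Hence `Δu = 2(1+δ)δ t^{2δ} e^{t^{2+2δ}}`, which is at least `u`
exactly because `2(1+δ)δ t^{2δ} ≥ 1` for `t ≥ t_δ`. The same cancellation bounds `|V|σ` by
`t^{-(1+δ)}`, so `V ∈ L¹`.

Passing to `V = -u₊` is a Kato-type argument. For a smooth convex `Ψ` vanishing near `(-∞, 0]`,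
`ΔΨ(u) ≥ Ψ'(u)Δu ≥ Ψ'(u)u ≥ Ψ(u)` wherever `u > 0` (`le_div_cutoffFlux`). Two integrations by parts
(`integral_radial_mul_laplaceBeltrami`) make this distributional, and letting `Ψ` tend uniformly to
the positive part concludes (`integral_witness_mul_nonneg`). -/

noncomputable section

namespace ModelSurface

/-! ### Rotationally symmetric metrics in Cartesian coordinates. -/

/-- The 1-form `v ↦ x₀ v₁ - x₁ v₀`, equal to `t² dθ` in polar coordinates. -/
def angularForm (x : Plane) : Plane →L[ℝ] ℝ :=
  x 0 • EuclideanSpace.proj (𝕜 := ℝ) (1 : Fin 2) - x 1 • EuclideanSpace.proj (𝕜 := ℝ) (0 : Fin 2)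

lemma angularForm_apply (x v : Plane) : angularForm x v = x 0 * v 1 - x 1 * v 0 := by
  simp [angularForm]

lemma normSq_eq (x : Plane) : ‖x‖ ^ 2 = x 0 ^ 2 + x 1 ^ 2 := by
  simp [EuclideanSpace.norm_sq_eq, Fin.sum_univ_two]

lemma inner_eq (v w : Plane) : inner ℝ v w = v 0 * w 0 + v 1 * w 1 := by
  simp [PiLp.inner_apply, Fin.sum_univ_two, mul_comm]

/-- The Euclidean inner product as a bilinear form. -/
def euclideanForm : Plane →L[ℝ] Plane →L[ℝ] ℝ := innerSL ℝ

lemma euclideanForm_apply (v w : Plane) : euclideanForm v w = inner ℝ v w := rfl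

/-- The bilinear form `⟨v, w⟩ + F(‖x‖²) (t² dθ)(v) (t² dθ)(w)`. -/
def radialForm (F : ℝ → ℝ) (x : Plane) : Plane →L[ℝ] Plane →L[ℝ] ℝ :=
  euclideanForm + F (‖x‖ ^ 2) • (angularForm x).smulRight (angularForm x)

lemma radialForm_apply (F : ℝ → ℝ) (x v w : Plane) :
    radialForm F x v w = inner ℝ v w + F (‖x‖ ^ 2) * (angularForm x v * angularForm x w) := by
  simp [radialForm, euclideanForm_apply]

lemma radialForm_symm (F : ℝ → ℝ) (x v w : Plane) : radialForm F x v w = radialForm F x w v := by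
  rw [radialForm_apply, radialForm_apply, real_inner_comm, mul_comm (angularForm x v)]

lemma contDiff_radialForm {F : ℝ → ℝ} (hF : ContDiff ℝ ∞ F) : ContDiff ℝ ∞ (radialForm F) := by
  refine contDiff_clm_apply_iff.2 fun v => contDiff_clm_apply_iff.2 fun w => ?_
  have h : ContDiff ℝ ∞ fun x : Plane => F (‖x‖ ^ 2) := hF.comp (contDiff_norm_sq ℝ)
  simp only [radialForm_apply, angularForm_apply]
  exact contDiff_const.add (h.mul (by fun_prop))

/-- For `x ≠ 0` the form has eigenvalue `1` in the radial direction and `1 + ‖x‖²F(‖x‖²)` in the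
angular one. The bound gives both positivity and bounded unit balls. -/
lemma mul_normSq_le_radialForm (F : ℝ → ℝ) (x v : Plane) :
    min 1 (1 + ‖x‖ ^ 2 * F (‖x‖ ^ 2)) * ‖v‖ ^ 2 ≤ radialForm F x v v := by
  rw [radialForm_apply, real_inner_self_eq_norm_sq, angularForm_apply]
  have h : (x 0 * v 1 - x 1 * v 0) * (x 0 * v 1 - x 1 * v 0) ≤ ‖x‖ ^ 2 * ‖v‖ ^ 2 := by
    rw [normSq_eq, normSq_eq]
    nlinarith [sq_nonneg (x 0 * v 0 + x 1 * v 1)]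
  have h0 := mul_self_nonneg (x 0 * v 1 - x 1 * v 0)
  rcases le_total 0 (F (‖x‖ ^ 2)) with hF | hF
  · nlinarith [min_le_left 1 (1 + ‖x‖ ^ 2 * F (‖x‖ ^ 2)), sq_nonneg ‖v‖, mul_nonneg hF h0]
  · nlinarith [min_le_right 1 (1 + ‖x‖ ^ 2 * F (‖x‖ ^ 2)), sq_nonneg ‖v‖,
      mul_nonneg (neg_nonneg.2 hF) (sub_nonneg.2 h)]

lemma radialForm_pos {F : ℝ → ℝ} {x v : Plane} (h : 0 < 1 + ‖x‖ ^ 2 * F (‖x‖ ^ 2))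
    (hv : v ≠ 0) : 0 < radialForm F x v v :=
  (mul_pos (lt_min one_pos h) (pow_pos (norm_pos_iff.2 hv) 2)).trans_le
    (mul_normSq_le_radialForm F x v)

lemma isVonNBounded_radialForm {F : ℝ → ℝ} {x : Plane} (h : 0 < 1 + ‖x‖ ^ 2 * F (‖x‖ ^ 2)) :
    Bornology.IsVonNBounded ℝ {v : Plane | radialForm F x v v < 1} := by
  rw [NormedSpace.isVonNBounded_iff, Metric.isBounded_iff_subset_closedBall 0]
  have hc : 0 < min 1 (1 + ‖x‖ ^ 2 * F (‖x‖ ^ 2)) := lt_min one_pos h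
  refine ⟨Real.sqrt (1 / min 1 (1 + ‖x‖ ^ 2 * F (‖x‖ ^ 2))), fun v hv => ?_⟩
  rw [mem_closedBall_zero_iff]
  apply Real.le_sqrt_of_sq_le
  rw [le_div_iff₀ hc]
  have := mul_normSq_le_radialForm F x v
  have hv' : radialForm F x v v < 1 := hv
  linarith

/-- The rotationally symmetric metric given by `radialForm F`. -/
def radialMetric (F : ℝ → ℝ) (hF : ContDiff ℝ ∞ F)
    (hpos : ∀ x : Plane, 0 < 1 + ‖x‖ ^ 2 * F (‖x‖ ^ 2)) : PlaneMetric where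
  inner x := radialForm F x
  symm x v w := radialForm_symm F x v w
  pos x v hv := radialForm_pos (hpos x) hv
  isVonNBounded x := isVonNBounded_radialForm (hpos x)
  contMDiff := by
    intro x
    refine (Bundle.contMDiffAt_section _).2 ?_
    refine ((contDiff_radialForm hF).contMDiff.contMDiffAt (x := x)).congr_of_eventuallyEq ?_
    refine .of_forall fun b => ?_
    dsimp only
    -- The tangent bundle of a model space is trivialised by the identity, so smoothness of the
    -- section is smoothness of `radialForm F`.
    have hS : ∀ v : Plane, (trivializationAt Plane (TangentSpace 𝓘(ℝ, Plane)) x).symm b v = v :=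
      fun v => (Bundle.Trivialization.symmL_apply _ (mem_univ b) v).symm.trans
        (congrArg (fun T : Plane →L[ℝ] Plane => T v) (TangentBundle.symmL_model_space x b))
    refine ContinuousLinearMap.ext fun v => ContinuousLinearMap.ext fun w => ?_
    refine (inCoordinates_apply_eq₂ (mem_univ _) (mem_univ _) (mem_univ _)).trans ?_
    refine (congrArg (fun T : ℝ →ₗ[ℝ] ℝ => T _)
      (Bundle.Trivial.linearMapAt_trivialization ℝ Plane ℝ b)).trans ?_
    exact congrArg₂ (fun v w => radialForm F b v w) (hS v) (hS w)

/-! ### Gram matrix, its inverse and determinant, and the polar form. -/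

section Gram

variable {F : ℝ → ℝ} (hF : ContDiff ℝ ∞ F) (hpos : ∀ x : Plane, 0 < 1 + ‖x‖ ^ 2 * F (‖x‖ ^ 2))

lemma metricInner_radialMetric (x v w : Plane) :
    metricInner (radialMetric F hF hpos) x v w = v 0 * w 0 + v 1 * w 1 +
      F (‖x‖ ^ 2) * ((x 0 * v 1 - x 1 * v 0) * (x 0 * w 1 - x 1 * w 0)) := by
  change radialForm F x v w = _
  rw [radialForm_apply, angularForm_apply, angularForm_apply, inner_eq]

lemma gram_radialMetric (x : Plane) :
    gram (radialMetric F hF hpos) x =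
      !![1 + F (‖x‖ ^ 2) * x 1 ^ 2, -(F (‖x‖ ^ 2) * (x 0 * x 1));
        -(F (‖x‖ ^ 2) * (x 0 * x 1)), 1 + F (‖x‖ ^ 2) * x 0 ^ 2] := by
  ext i j
  fin_cases i <;> fin_cases j <;>
    simp only [gram, metricInner_radialMetric, stdVec, Matrix.of_apply, Fin.zero_eta,
      Fin.mk_one, PiLp.single_apply, Fin.isValue, Matrix.cons_val', Matrix.cons_val_zero,
      Matrix.cons_val_one, Matrix.cons_val_fin_one, one_ne_zero, zero_ne_one, if_true, if_false] <;>
    ring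

lemma det_gram_radialMetric (x : Plane) :
    (gram (radialMetric F hF hpos) x).det = 1 + ‖x‖ ^ 2 * F (‖x‖ ^ 2) := by
  rw [gram_radialMetric, Matrix.det_fin_two_of]
  have := normSq_eq x
  linear_combination (-F (‖x‖ ^ 2)) * this

lemma inv_gram_radialMetric (x : Plane) :
    (gram (radialMetric F hF hpos) x)⁻¹ = (1 + ‖x‖ ^ 2 * F (‖x‖ ^ 2))⁻¹ •
      !![1 + F (‖x‖ ^ 2) * x 0 ^ 2, F (‖x‖ ^ 2) * (x 0 * x 1);
        F (‖x‖ ^ 2) * (x 0 * x 1), 1 + F (‖x‖ ^ 2) * x 1 ^ 2] := by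
  rw [Matrix.inv_def, det_gram_radialMetric, gram_radialMetric, Matrix.adjugate_fin_two_of]
  simp

lemma volDensity_radialMetric (x : Plane) :
    volDensity (radialMetric F hF hpos) x = Real.sqrt (1 + ‖x‖ ^ 2 * F (‖x‖ ^ 2)) := by
  rw [volDensity, det_gram_radialMetric]

lemma isModelMetric_radialMetric {σ : ℝ → ℝ} (hσ : ContDiffOn ℝ ∞ σ (Ioi 0))
    (hσ0 : ∀ t, 0 < t → 0 < σ t)
    (h : ∀ t, 0 < t → σ t ^ 2 = t ^ 2 * (1 + t ^ 2 * F (t ^ 2))) :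
    IsModelMetric (radialMetric F hF hpos) σ := by
  refine ⟨hσ, hσ0, fun t θ ht => ?_⟩
  have hn : ‖(!₂[t * Real.cos θ, t * Real.sin θ] : Plane)‖ ^ 2 = t ^ 2 := by
    rw [normSq_eq]
    simp only [Matrix.cons_val_zero, Matrix.cons_val_one]
    linear_combination t ^ 2 * Real.sin_sq_add_cos_sq θ
  have hc := Real.sin_sq_add_cos_sq θ
  simp only [metricInner_radialMetric, hn, h t ht]
  simp only [Matrix.cons_val_zero, Matrix.cons_val_one]
  refine ⟨?_, ?_, ?_⟩
  · linear_combination hc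
  · ring
  · linear_combination (t ^ 2 + t ^ 4 * F (t ^ 2) * (Real.sin θ ^ 2 + Real.cos θ ^ 2 + 1)) * hc

end Gram

/-! ### The distance from the pole is the Euclidean norm. -/

section Distance

variable {F : ℝ → ℝ} (hF : ContDiff ℝ ∞ F) (hpos : ∀ x : Plane, 0 < 1 + ‖x‖ ^ 2 * F (‖x‖ ^ 2))

/-- The radial part of the metric is dominated by the metric. -/
lemma sq_inner_le_radialForm {F : ℝ → ℝ} {x : Plane} (h : 0 < 1 + ‖x‖ ^ 2 * F (‖x‖ ^ 2))
    (v : Plane) : inner ℝ x v ^ 2 ≤ ‖x‖ ^ 2 * radialForm F x v v := by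
  -- Lagrange's identity: it turns the difference of the two sides into `(1 + ‖x‖²F)` times the
  -- square of the angular form.
  have h1 : ‖x‖ ^ 2 * ‖v‖ ^ 2 = inner ℝ x v ^ 2 + angularForm x v ^ 2 := by
    rw [normSq_eq, normSq_eq, inner_eq, angularForm_apply]
    ring
  rw [radialForm_apply, real_inner_self_eq_norm_sq]
  nlinarith [mul_nonneg h.le (sq_nonneg (angularForm x v))]

/-- A smooth approximation of the norm. -/
def smoothNorm (η : ℝ) (x : Plane) : ℝ := Real.sqrt (η ^ 2 + ‖x‖ ^ 2)

lemma contDiff_smoothNorm {η : ℝ} (hη : 0 < η) : ContDiff ℝ 1 (smoothNorm η) := by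
  have h : ContDiff ℝ 1 fun x : Plane => η ^ 2 + ‖x‖ ^ 2 :=
    contDiff_const.add (contDiff_norm_sq ℝ)
  exact h.sqrt fun x => by positivity

lemma fderiv_smoothNorm {η : ℝ} (hη : 0 < η) (x v : Plane) :
    fderiv ℝ (smoothNorm η) x v = inner ℝ x v / Real.sqrt (η ^ 2 + ‖x‖ ^ 2) := by
  have h : HasFDerivAt (fun x : Plane => η ^ 2 + ‖x‖ ^ 2) (2 • (innerSL ℝ x)) x :=
    (hasStrictFDerivAt_norm_sq x).hasFDerivAt.const_add _
  have h2 := (h.sqrt (by positivity)).fderiv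
  unfold smoothNorm
  rw [h2]
  simp
  field_simp

lemma abs_fderiv_smoothNorm_le {F : ℝ → ℝ} {η : ℝ} (hη : 0 < η) {x : Plane}
    (h : 0 < 1 + ‖x‖ ^ 2 * F (‖x‖ ^ 2)) (v : Plane) :
    |fderiv ℝ (smoothNorm η) x v| ≤ Real.sqrt (radialForm F x v v) := by
  have h1 := sq_inner_le_radialForm h v
  have h0 : 0 ≤ radialForm F x v v := by
    rcases eq_or_ne v 0 with rfl | hv
    · simp
    · exact (radialForm_pos h hv).le
  rw [fderiv_smoothNorm hη]
  apply Real.abs_le_sqrt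
  rw [div_pow, Real.sq_sqrt (by positivity), div_le_iff₀ (by positivity)]
  nlinarith [mul_nonneg (sq_nonneg η) h0]

/-- `smoothNorm η` is differentiable at the pole, unlike the norm, and its differential is bounded
by the `g`-length of vectors. Along any path it therefore grows by at most the length, while from
`0` to `x` it grows by at least `‖x‖ - η`; then `η → 0`. -/
lemma le_riemannianDist_radialMetric (x : Plane) :
    ENNReal.ofReal ‖x‖ ≤ riemannianDist (radialMetric F hF hpos) 0 x := by
  have key : ∀ η : ℝ, 0 < η → ENNReal.ofReal (‖x‖ - η) ≤
      riemannianDist (radialMetric F hF hpos) 0 x := by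
    intro η hη
    unfold riemannianDist
    let _ : ∀ z : Plane, ENorm (TangentSpace 𝓘(ℝ, Plane) z) := fun z =>
      ⟨fun v => ENNReal.ofReal (Real.sqrt ((radialMetric F hF hpos).inner z v v))⟩
    refine le_of_forall_gt fun r hr => ?_
    obtain ⟨γ, h0, h1, hγ, hlt⟩ := Manifold.exists_lt_of_riemannianEDist_lt hr
    refine lt_of_le_of_lt ?_ hlt
    have hγ' : ContDiffOn ℝ 1 γ (Icc 0 1) := contMDiffOn_iff_contDiffOn.mp hγ
    have hD : ContDiffOn ℝ 1 (smoothNorm η ∘ γ) (Icc 0 1) :=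
      (contDiff_smoothNorm hη).comp_contDiffOn hγ'
    rw [Manifold.pathELength_eq_lintegral_mfderivWithin_Icc]
    have h2 := enorm_sub_le_lintegral_derivWithin_Icc_of_contDiffOn_Icc hD zero_le_one
    have h3 : ENNReal.ofReal (‖x‖ - η) ≤ ‖(smoothNorm η ∘ γ) 1 - (smoothNorm η ∘ γ) 0‖ₑ := by
      rw [Real.enorm_eq_ofReal_abs]
      apply ENNReal.ofReal_le_ofReal
      refine le_trans ?_ (le_abs_self _)
      simp only [Function.comp, h0, h1, smoothNorm]
      have : ‖x‖ ≤ Real.sqrt (η ^ 2 + ‖x‖ ^ 2) := Real.le_sqrt_of_sq_le (by nlinarith)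
      have h4 : Real.sqrt (η ^ 2 + ‖(0 : Plane)‖ ^ 2) = η := by simp [Real.sqrt_sq hη.le]
      linarith
    refine (h3.trans h2).trans (setLIntegral_mono' measurableSet_Icc fun t ht => ?_)
    have hu : UniqueDiffWithinAt ℝ (Icc (0 : ℝ) 1) t := uniqueDiffOn_Icc zero_lt_one t ht
    have h5 : derivWithin (smoothNorm η ∘ γ) (Icc 0 1) t =
        fderiv ℝ (smoothNorm η) (γ t) (fderivWithin ℝ γ (Icc 0 1) t 1) := by
      have h6 := (contDiff_smoothNorm hη).differentiable one_ne_zero (γ t)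
      have h7 := hγ'.differentiableOn one_ne_zero t ht
      rw [← fderivWithin_derivWithin, fderiv_comp_fderivWithin t h6 h7 hu]
      rfl
    rw [h5, Real.enorm_eq_ofReal_abs, mfderivWithin_eq_fderivWithin]
    exact ENNReal.ofReal_le_ofReal (abs_fderiv_smoothNorm_le hη (hpos _) _)
  refine le_of_tendsto (x := 𝓝[>] (0 : ℝ)) (f := fun η => ENNReal.ofReal (‖x‖ - η)) ?_ ?_
  · have h : Tendsto (fun η : ℝ => ENNReal.ofReal (‖x‖ - η)) (𝓝 0)
        (𝓝 (ENNReal.ofReal (‖x‖ - 0))) :=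
      (ENNReal.continuous_ofReal.comp (continuous_const.sub continuous_id)).tendsto 0
    rw [sub_zero] at h
    exact h.mono_left nhdsWithin_le_nhds
  · filter_upwards [self_mem_nhdsWithin] with η hη using key η hη

/-- The straight segment from the pole has velocity `x`, which the angular form annihilates, so its
length is `‖x‖`. -/
lemma riemannianDist_radialMetric_le (x : Plane) :
    riemannianDist (radialMetric F hF hpos) 0 x ≤ ENNReal.ofReal ‖x‖ := by
  unfold riemannianDist
  let _ : ∀ z : Plane, ENorm (TangentSpace 𝓘(ℝ, Plane) z) := fun z =>
    ⟨fun v => ENNReal.ofReal (Real.sqrt ((radialMetric F hF hpos).inner z v v))⟩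
  have : ∀ z : Plane, ENormSMulClass ℝ (TangentSpace 𝓘(ℝ, Plane) z) := fun z => ⟨fun c v => by
    have h : ∀ w : Plane, radialForm F z (c • w) (c • w) = c ^ 2 * radialForm F z w w := by
      intro w
      simp only [map_smul, _root_.smul_apply, smul_eq_mul]
      ring
    change ENNReal.ofReal (Real.sqrt (radialForm F z (c • (v : Plane)) (c • (v : Plane)))) = ‖c‖ₑ *
      ENNReal.ofReal (Real.sqrt (radialForm F z v v))
    rw [Real.enorm_eq_ofReal_abs, ← ENNReal.ofReal_mul (abs_nonneg c), ← Real.sqrt_sq_eq_abs,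
      ← Real.sqrt_mul (sq_nonneg c)]
    exact congrArg (fun r => ENNReal.ofReal (Real.sqrt r)) (h v)⟩
  have h : Manifold.riemannianEDist 𝓘(ℝ, Plane) (0 : Plane) x ≤
      Manifold.pathELength 𝓘(ℝ, Plane) (fun t : ℝ => t • x) 0 1 := by
    apply Manifold.riemannianEDist_le_pathELength _ (by simp) (by simp) zero_le_one
    rw [contMDiffOn_iff_contDiffOn]
    fun_prop
  refine h.trans ?_
  rw [Manifold.pathELength_eq_lintegral_mfderiv_Icc]
  have h2 : ∀ t ∈ Icc (0 : ℝ) 1,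
      ‖mfderiv 𝓘(ℝ, ℝ) 𝓘(ℝ, Plane) (fun t : ℝ => t • x) t 1‖ₑ ≤ ENNReal.ofReal ‖x‖ := by
    intro t ht
    rw [mfderiv_eq_fderiv]
    change ENNReal.ofReal (Real.sqrt (radialForm F (t • x) (fderiv ℝ (fun t : ℝ => t • x) t 1)
      (fderiv ℝ (fun t : ℝ => t • x) t 1))) ≤ _
    have h3 : fderiv ℝ (fun t : ℝ => t • x) t 1 = x := by
      rw [fderiv_apply_one_eq_deriv]
      simpa using ((hasDerivAt_id t).smul_const x).deriv
    rw [h3, radialForm_apply, angularForm_apply, real_inner_self_eq_norm_sq]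
    simp only [PiLp.smul_apply, smul_eq_mul]
    rw [show t * x 0 * x 1 - t * x 1 * x 0 = 0 by ring]
    simp [Real.sqrt_sq (norm_nonneg x)]
  refine (setLIntegral_mono' measurableSet_Icc h2).trans ?_
  simp

lemma riemannianDist_radialMetric (x : Plane) :
    riemannianDist (radialMetric F hF hpos) 0 x = ENNReal.ofReal ‖x‖ :=
  le_antisymm (riemannianDist_radialMetric_le hF hpos x) (le_riemannianDist_radialMetric hF hpos x)

end Distance

/-! ### A calculus tracking both partial derivatives in closed form. -/

section Partials

/-- `f` is differentiable at `x` with partial derivatives `a` and `b`. -/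
def HasPartials (f : Plane → ℝ) (x : Plane) (a b : ℝ) : Prop :=
  HasFDerivAt f (a • EuclideanSpace.proj (𝕜 := ℝ) (0 : Fin 2) +
    b • EuclideanSpace.proj (𝕜 := ℝ) (1 : Fin 2) : Plane →L[ℝ] ℝ) x

variable {f g : Plane → ℝ} {x : Plane} {a b c d : ℝ}

lemma HasPartials.partialDeriv_zero (h : HasPartials f x a b) : partialDeriv 0 f x = a := by
  rw [partialDeriv, HasFDerivAt.fderiv h]
  simp [stdVec]

lemma HasPartials.partialDeriv_one (h : HasPartials f x a b) : partialDeriv 1 f x = b := by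
  rw [partialDeriv, HasFDerivAt.fderiv h]
  simp [stdVec]

lemma HasPartials.congr (h : HasPartials f x a b) (hfg : ∀ y, g y = f y) (hc : c = a)
    (hd : d = b) : HasPartials g x c d := by
  obtain rfl : g = f := funext hfg
  exact hc ▸ hd ▸ h

lemma hasPartials_const (c : ℝ) (x : Plane) : HasPartials (fun _ => c) x 0 0 := by
  simpa [HasPartials] using hasFDerivAt_const c x

lemma hasPartials_zero (x : Plane) : HasPartials (fun y => y 0) x 1 0 := by
  simpa [HasPartials] using (EuclideanSpace.proj (𝕜 := ℝ) (0 : Fin 2)).hasFDerivAt (x := x)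

lemma hasPartials_one (x : Plane) : HasPartials (fun y => y 1) x 0 1 := by
  simpa [HasPartials] using (EuclideanSpace.proj (𝕜 := ℝ) (1 : Fin 2)).hasFDerivAt (x := x)

lemma HasPartials.add (hf : HasPartials f x a b) (hg : HasPartials g x c d) :
    HasPartials (fun y => f y + g y) x (a + c) (b + d) := by
  unfold HasPartials at *
  refine HasFDerivAt.congr_fderiv (HasFDerivAt.add hf hg) ?_
  ext v
  simp
  ring

lemma HasPartials.mul (hf : HasPartials f x a b) (hg : HasPartials g x c d) :
    HasPartials (fun y => f y * g y) x (a * g x + f x * c) (b * g x + f x * d) := by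
  unfold HasPartials at *
  refine HasFDerivAt.congr_fderiv (HasFDerivAt.mul hf hg) ?_
  ext v
  simp
  ring

lemma HasPartials.comp {u : ℝ → ℝ} {u' : ℝ} (hu : HasDerivAt u u' (f x))
    (hf : HasPartials f x a b) : HasPartials (fun y => u (f y)) x (u' * a) (u' * b) := by
  unfold HasPartials at *
  refine HasFDerivAt.congr_fderiv (hu.comp_hasFDerivAt x hf) ?_
  ext v
  simp
  ring

lemma HasPartials.neg (hf : HasPartials f x a b) : HasPartials (fun y => -f y) x (-a) (-b) := by
  unfold HasPartials at *
  refine HasFDerivAt.congr_fderiv (HasFDerivAt.neg hf) ?_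
  ext v
  simp
  ring

lemma hasPartials_normSq (x : Plane) :
    HasPartials (fun y => ‖y‖ ^ 2) x (2 * x 0) (2 * x 1) := by
  have h := ((hasPartials_zero x).mul (hasPartials_zero x)).add
    ((hasPartials_one x).mul (hasPartials_one x))
  exact h.congr (fun y => by rw [normSq_eq]; ring) (by ring) (by ring)

end Partials

/-! ### Christoffel symbols and Gaussian curvature of a radial metric. -/

section Curvature

variable {F F₁ F₂ : ℝ → ℝ} (hF : ContDiff ℝ ∞ F)
  (hpos : ∀ x : Plane, 0 < 1 + ‖x‖ ^ 2 * F (‖x‖ ^ 2))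

lemma HasPartials.radial {u : ℝ → ℝ} {u' : ℝ} {x : Plane} (h : HasDerivAt u u' (‖x‖ ^ 2)) :
    HasPartials (fun y => u (‖y‖ ^ 2)) x (u' * (2 * x 0)) (u' * (2 * x 1)) :=
  HasPartials.comp (f := fun y : Plane => ‖y‖ ^ 2) h (hasPartials_normSq x)

lemma hasPartials_gram_zero_zero {u' : ℝ} (x : Plane) (h : HasDerivAt F u' (‖x‖ ^ 2)) :
    HasPartials (fun y => gram (radialMetric F hF hpos) y 0 0) x
      (2 * u' * x 0 * x 1 ^ 2) (2 * u' * x 1 ^ 3 + 2 * F (‖x‖ ^ 2) * x 1) :=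
  ((hasPartials_const 1 x).add ((HasPartials.radial h).mul
    ((hasPartials_one x).mul (hasPartials_one x)))).congr
      (fun y => by simp [gram_radialMetric, pow_two]) (by ring) (by ring)

lemma hasPartials_gram_one_one {u' : ℝ} (x : Plane) (h : HasDerivAt F u' (‖x‖ ^ 2)) :
    HasPartials (fun y => gram (radialMetric F hF hpos) y 1 1) x
      (2 * u' * x 0 ^ 3 + 2 * F (‖x‖ ^ 2) * x 0) (2 * u' * x 0 ^ 2 * x 1) :=
  ((hasPartials_const 1 x).add ((HasPartials.radial h).mul
    ((hasPartials_zero x).mul (hasPartials_zero x)))).congr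
      (fun y => by simp [gram_radialMetric, pow_two]) (by ring) (by ring)

lemma hasPartials_gram_zero_one {u' : ℝ} (x : Plane) (h : HasDerivAt F u' (‖x‖ ^ 2)) :
    HasPartials (fun y => gram (radialMetric F hF hpos) y 0 1) x
      (-(2 * u' * x 0 ^ 2 * x 1 + F (‖x‖ ^ 2) * x 1))
      (-(2 * u' * x 0 * x 1 ^ 2 + F (‖x‖ ^ 2) * x 0)) :=
  ((HasPartials.radial h).mul ((hasPartials_zero x).mul (hasPartials_one x))).neg.congr
      (fun y => by simp [gram_radialMetric]) (by ring) (by ring)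

lemma hasPartials_gram_one_zero {u' : ℝ} (x : Plane) (h : HasDerivAt F u' (‖x‖ ^ 2)) :
    HasPartials (fun y => gram (radialMetric F hF hpos) y 1 0) x
      (-(2 * u' * x 0 ^ 2 * x 1 + F (‖x‖ ^ 2) * x 1))
      (-(2 * u' * x 0 * x 1 ^ 2 + F (‖x‖ ^ 2) * x 0)) :=
  ((HasPartials.radial h).mul ((hasPartials_zero x).mul (hasPartials_one x))).neg.congr
      (fun y => by simp [gram_radialMetric]) (by ring) (by ring)

/-- The matrix indexed by `k` is the adjugate of the Gram matrix; the two indexed by `i j` are the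
symbols of the first kind, with lowered index `0` and `1`. -/
lemma christoffel_radialMetric (hF₁ : ∀ ρ, HasDerivAt F (F₁ ρ) ρ) (k i j : Fin 2) (x : Plane) :
    christoffel (radialMetric F hF hpos) k i j x = (1 + ‖x‖ ^ 2 * F (‖x‖ ^ 2))⁻¹ *
      (!![1 + F (‖x‖ ^ 2) * x 0 ^ 2, F (‖x‖ ^ 2) * (x 0 * x 1);
        F (‖x‖ ^ 2) * (x 0 * x 1), 1 + F (‖x‖ ^ 2) * x 1 ^ 2] k 0 *
          !![F₁ (‖x‖ ^ 2) * x 0 * x 1 ^ 2, F₁ (‖x‖ ^ 2) * x 1 ^ 3 + F (‖x‖ ^ 2) * x 1;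
            F₁ (‖x‖ ^ 2) * x 1 ^ 3 + F (‖x‖ ^ 2) * x 1,
            -(2 * F₁ (‖x‖ ^ 2) * x 0 * x 1 ^ 2 + F₁ (‖x‖ ^ 2) * x 0 ^ 3
              + 2 * F (‖x‖ ^ 2) * x 0)] i j +
        !![1 + F (‖x‖ ^ 2) * x 0 ^ 2, F (‖x‖ ^ 2) * (x 0 * x 1);
          F (‖x‖ ^ 2) * (x 0 * x 1), 1 + F (‖x‖ ^ 2) * x 1 ^ 2] k 1 *
          !![-(2 * F₁ (‖x‖ ^ 2) * x 0 ^ 2 * x 1 + F₁ (‖x‖ ^ 2) * x 1 ^ 3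
              + 2 * F (‖x‖ ^ 2) * x 1), F₁ (‖x‖ ^ 2) * x 0 ^ 3 + F (‖x‖ ^ 2) * x 0;
            F₁ (‖x‖ ^ 2) * x 0 ^ 3 + F (‖x‖ ^ 2) * x 0, F₁ (‖x‖ ^ 2) * x 0 ^ 2 * x 1] i j) := by
  have h00 := hasPartials_gram_zero_zero hF hpos x (hF₁ _)
  have h01 := hasPartials_gram_zero_one hF hpos x (hF₁ _)
  have h10 := hasPartials_gram_one_zero hF hpos x (hF₁ _)
  have h11 := hasPartials_gram_one_one hF hpos x (hF₁ _)
  fin_cases k <;> fin_cases i <;> fin_cases j <;>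
  · simp only [christoffel, Fin.sum_univ_two, inv_gram_radialMetric, Fin.zero_eta, Fin.mk_one,
      h00.partialDeriv_zero, h00.partialDeriv_one, h01.partialDeriv_zero, h01.partialDeriv_one,
      h10.partialDeriv_zero, h10.partialDeriv_one, h11.partialDeriv_zero, h11.partialDeriv_one,
      Matrix.smul_apply, Matrix.of_apply, Matrix.cons_val', Matrix.cons_val_zero,
      Matrix.cons_val_one, Matrix.cons_val_fin_one, smul_eq_mul]
    ring

/-- With `D = (σ/t)²` as a function of `ρ = t²`, the right side is `-σ''/σ`. It involves `F` only
through `D`, `D'` and `D''`, which are easy to evaluate when `D` is an exponential. -/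
lemma gaussianCurvature_radialMetric (hF₁ : ∀ ρ, HasDerivAt F (F₁ ρ) ρ)
    (hF₂ : ∀ ρ, HasDerivAt F₁ (F₂ ρ) ρ) (x : Plane) {ρ D D₁ D₂ : ℝ} (hρ : ρ = ‖x‖ ^ 2)
    (hD : D = 1 + ρ * F ρ) (hD₁ : D₁ = F ρ + ρ * F₁ ρ) (hD₂ : D₂ = 2 * F₁ ρ + ρ * F₂ ρ) :
    gaussianCurvature (radialMetric F hF hpos) x =
      -(3 * D₁ / D + 2 * ρ * D₂ / D - ρ * D₁ ^ 2 / D ^ 2) := by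
  have hx := (hpos x).ne'
  have hA := hasPartials_zero x
  have hB := hasPartials_one x
  have hu := HasPartials.radial (x := x) (hF₁ _)
  have hv := HasPartials.radial (x := x) (hF₂ _)
  have hI := HasPartials.comp (f := fun y : Plane => 1 + ‖y‖ ^ 2 * F (‖y‖ ^ 2))
    (hasDerivAt_inv hx) ((hasPartials_const 1 x).add ((hasPartials_normSq x).mul hu))
  have hP := (hasPartials_const 1 x).add (hu.mul (hA.mul hA))
  have hQ := hu.mul (hA.mul hB)
  have hR := (hasPartials_const 1 x).add (hu.mul (hB.mul hB))
  have h001 := (hv.mul (hB.mul (hB.mul hB))).add (hu.mul hB)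
  have h101 := (hv.mul (hA.mul (hA.mul hA))).add (hu.mul hA)
  have h011 := (((hasPartials_const 2 x).mul (hv.mul (hA.mul (hB.mul hB)))).add
    ((hv.mul (hA.mul (hA.mul hA))).add ((hasPartials_const 2 x).mul (hu.mul hA)))).neg
  have h111 := hv.mul (hA.mul (hA.mul hB))
  -- Only the symbols with lower indices `01` and `11` are differentiated in the components `R(∂₀,
  -- ∂₁)∂₁`.
  have c001 := (hI.mul ((hP.mul h001).add (hQ.mul h101))).congr
    (g := christoffel (radialMetric F hF hpos) 0 0 1) (fun y => by
      simp only [christoffel_radialMetric hF hpos hF₁, Matrix.of_apply, Matrix.cons_val',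
        Matrix.cons_val_zero, Matrix.cons_val_one, Matrix.cons_val_fin_one]
      ring) rfl rfl
  have c101 := (hI.mul ((hQ.mul h001).add (hR.mul h101))).congr
    (g := christoffel (radialMetric F hF hpos) 1 0 1) (fun y => by
      simp only [christoffel_radialMetric hF hpos hF₁, Matrix.of_apply, Matrix.cons_val',
        Matrix.cons_val_zero, Matrix.cons_val_one, Matrix.cons_val_fin_one]
      ring) rfl rfl
  have c011 := (hI.mul ((hP.mul h011).add (hQ.mul h111))).congr
    (g := christoffel (radialMetric F hF hpos) 0 1 1) (fun y => by
      simp only [christoffel_radialMetric hF hpos hF₁, Matrix.of_apply, Matrix.cons_val',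
        Matrix.cons_val_zero, Matrix.cons_val_one, Matrix.cons_val_fin_one]
      ring) rfl rfl
  have c111 := (hI.mul ((hQ.mul h011).add (hR.mul h111))).congr
    (g := christoffel (radialMetric F hF hpos) 1 1 1) (fun y => by
      simp only [christoffel_radialMetric hF hpos hF₁, Matrix.of_apply, Matrix.cons_val',
        Matrix.cons_val_zero, Matrix.cons_val_one, Matrix.cons_val_fin_one]
      ring) rfl rfl
  simp only [gaussianCurvature, curvatureTensor, Fin.sum_univ_two, det_gram_radialMetric,
    c001.partialDeriv_one, c101.partialDeriv_one, c011.partialDeriv_zero, c111.partialDeriv_zero]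
  simp only [christoffel_radialMetric hF hpos hF₁, gram_radialMetric, Matrix.of_apply,
    Matrix.cons_val', Matrix.cons_val_zero, Matrix.cons_val_one, Matrix.cons_val_fin_one]
  subst hρ hD₁ hD₂ hD
  generalize F₂ (‖x‖ ^ 2) = w
  generalize F₁ (‖x‖ ^ 2) = v
  generalize F (‖x‖ ^ 2) = u at *
  have hn := normSq_eq x
  clear * - hx hn
  generalize ‖x‖ ^ 2 = ρ at *
  generalize x 0 = a at *
  generalize x 1 = b at *
  -- With `D` opaque, `field_simp` clears it as a single nonzero denominator; substituting `ρ = a² +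
  -- b²` then leaves a polynomial identity.
  obtain ⟨D, hD⟩ : ∃ D, D = 1 + ρ * u := ⟨_, rfl⟩
  rw [← hD] at hx ⊢
  field_simp
  subst hD hn
  ring

end Curvature

/-! ### Integration by parts for radial functions. -/

section WeakLaplacian

lemma contDiff_partialDeriv {φ : Plane → ℝ} {n m : ℕ∞ω} (hφ : ContDiff ℝ n φ) (h : m + 1 ≤ n)
    (i : Fin 2) : ContDiff ℝ m (partialDeriv i φ) :=
  (hφ.fderiv_right h).clm_apply contDiff_const

lemma hasCompactSupport_partialDeriv {φ : Plane → ℝ} (hφ : HasCompactSupport φ) (i : Fin 2) :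
    HasCompactSupport (partialDeriv i φ) :=
  hφ.fderiv_apply ℝ _

/-- Integration by parts against a compactly supported function. -/
lemma integral_mul_partialDeriv {u T : Plane → ℝ} (hu : ContDiff ℝ 1 u) (hT : ContDiff ℝ 1 T)
    (hc : HasCompactSupport T) (i : Fin 2) :
    ∫ x, u x * partialDeriv i T x = -∫ x, partialDeriv i u x * T x := by
  have hT' := (contDiff_partialDeriv hT (m := 0) (by simp) i).continuous
  have hu' := (contDiff_partialDeriv hu (m := 0) (by simp) i).continuous
  refine integral_mul_fderiv_eq_neg_fderiv_mul_of_integrable ?_ ?_ ?_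
    (fun x _ => hu.differentiable one_ne_zero x) (fun x _ => hT.differentiable one_ne_zero x)
  · exact (hu'.mul hT.continuous).integrable_of_hasCompactSupport hc.mul_left
  · exact (hu.continuous.mul hT').integrable_of_hasCompactSupport
      (hasCompactSupport_partialDeriv hc i).mul_left
  · exact (hu.continuous.mul hT.continuous).integrable_of_hasCompactSupport hc.mul_left

lemma integrable_mul_partialDeriv {u T : Plane → ℝ} (hu : Continuous u) (hT : ContDiff ℝ 1 T)
    (hc : HasCompactSupport T) (i : Fin 2) : Integrable fun x => u x * partialDeriv i T x :=
  (hu.mul (contDiff_partialDeriv hT (m := 0) (by simp) i).continuous).integrable_of_hasCompactSupport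
    (hasCompactSupport_partialDeriv hc i).mul_left

lemma integrable_partialDeriv_mul {u T : Plane → ℝ} (hu : ContDiff ℝ 1 u) (hT : Continuous T)
    (hc : HasCompactSupport T) (i : Fin 2) : Integrable fun x => partialDeriv i u x * T x :=
  ((contDiff_partialDeriv hu (m := 0) (by simp) i).continuous.mul hT).integrable_of_hasCompactSupport
    hc.mul_left

variable {F f : ℝ → ℝ} (hF : ContDiff ℝ ∞ F)
  (hpos : ∀ x : Plane, 0 < 1 + ‖x‖ ^ 2 * F (‖x‖ ^ 2))

/-- The vector field `√(det g) ∇φ`, split into its summands. -/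
def gradTerm (g : PlaneMetric) (φ : Plane → ℝ) (i j : Fin 2) (y : Plane) : ℝ :=
  volDensity g y * (gram g y)⁻¹ i j * partialDeriv j φ y

lemma volDensity_pos (x : Plane) : 0 < volDensity (radialMetric F hF hpos) x := by
  rw [volDensity_radialMetric]
  exact Real.sqrt_pos.2 (hpos x)

lemma volDensity_mul_laplaceBeltrami (φ : Plane → ℝ) (x : Plane) :
    volDensity (radialMetric F hF hpos) x * laplaceBeltrami (radialMetric F hF hpos) φ x =
      ∑ i, ∑ j, partialDeriv i (gradTerm (radialMetric F hF hpos) φ i j) x := by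
  rw [laplaceBeltrami, ← mul_assoc, mul_inv_cancel₀ (volDensity_pos hF hpos x).ne', one_mul]
  rfl

lemma contDiff_radial {u : ℝ → ℝ} (hu : ContDiff ℝ ∞ u) :
    ContDiff ℝ ∞ fun x : Plane => u (‖x‖ ^ 2) := hu.comp (contDiff_norm_sq ℝ)

include hpos in
lemma contDiff_volDensity : ContDiff ℝ ∞ (volDensity (radialMetric F hF hpos)) := by
  have h : volDensity (radialMetric F hF hpos) =
      fun x => Real.sqrt (1 + ‖x‖ ^ 2 * F (‖x‖ ^ 2)) :=
    funext (volDensity_radialMetric hF hpos)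
  rw [h]
  exact (contDiff_const.add ((contDiff_norm_sq ℝ).mul (contDiff_radial hF))).sqrt
    fun x => (hpos x).ne'

lemma contDiff_inv_gram (i j : Fin 2) :
    ContDiff ℝ ∞ fun x => (gram (radialMetric F hF hpos) x)⁻¹ i j := by
  have h1 : ContDiff ℝ ∞ fun x : Plane => (1 + ‖x‖ ^ 2 * F (‖x‖ ^ 2))⁻¹ :=
    (contDiff_const.add ((contDiff_norm_sq ℝ).mul (contDiff_radial hF))).inv fun x => (hpos x).ne'
  have h2 := contDiff_radial hF
  have h3 : ContDiff ℝ ∞ fun x : Plane => x 0 := by fun_prop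
  have h4 : ContDiff ℝ ∞ fun x : Plane => x 1 := by fun_prop
  simp only [inv_gram_radialMetric]
  fin_cases i <;> fin_cases j
  · exact h1.mul (contDiff_const.add (h2.mul (h3.pow 2)))
  · exact h1.mul (h2.mul (h3.mul h4))
  · exact h1.mul (h2.mul (h3.mul h4))
  · exact h1.mul (contDiff_const.add (h2.mul (h4.pow 2)))

lemma contDiff_gradTerm {φ : Plane → ℝ} (hφ : ContDiff ℝ ∞ φ) (i j : Fin 2) :
    ContDiff ℝ ∞ (gradTerm (radialMetric F hF hpos) φ i j) :=
  ((contDiff_volDensity hF hpos).mul (contDiff_inv_gram hF hpos i j)).mul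
    (contDiff_partialDeriv hφ (by simp) j)

lemma hasCompactSupport_gradTerm (g : PlaneMetric) {φ : Plane → ℝ} (hφ : HasCompactSupport φ)
    (i j : Fin 2) : HasCompactSupport (gradTerm g φ i j) :=
  (hasCompactSupport_partialDeriv hφ j).mul_left

/-- The metric is Euclidean against the radial direction: `g(x, ·) = ⟨x, ·⟩`. Hence `g⁻¹` fixes `x`,
and radial functions have radial gradients with Euclidean coefficients. -/
lemma sum_mul_inv_gram (x : Plane) (j : Fin 2) :
    ∑ i, x i * (gram (radialMetric F hF hpos) x)⁻¹ i j = x j := by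
  have hx := (hpos x).ne'
  have hn := normSq_eq x
  rw [inv_gram_radialMetric]
  generalize F (‖x‖ ^ 2) = u at *
  generalize ‖x‖ ^ 2 = ρ at *
  obtain ⟨D, hD⟩ : ∃ D, D = 1 + ρ * u := ⟨_, rfl⟩
  rw [← hD] at hx ⊢
  fin_cases j <;>
  · simp only [Fin.sum_univ_two, Matrix.smul_apply, Matrix.of_apply, Matrix.cons_val',
      Matrix.cons_val_zero, Matrix.cons_val_one, Matrix.cons_val_fin_one, smul_eq_mul,
      Fin.zero_eta, Fin.mk_one]
    field_simp
    subst hD hn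
    ring

/-- For a radial function `u`, the Laplacian can be moved from the test function to `u`. -/
lemma integral_radial_mul_laplaceBeltrami {φ : Plane → ℝ} (hφ : ContDiff ℝ ∞ φ)
    (hc : HasCompactSupport φ) {u u₁ p : ℝ → ℝ} (hU : ContDiff ℝ 1 fun x : Plane => u (‖x‖ ^ 2))
    (hu₁ : ∀ x : Plane, HasDerivAt u (u₁ (‖x‖ ^ 2)) (‖x‖ ^ 2))
    (hP : ContDiff ℝ 1 fun x : Plane => p (‖x‖ ^ 2))
    (hp : ∀ x : Plane, p (‖x‖ ^ 2) = volDensity (radialMetric F hF hpos) x * u₁ (‖x‖ ^ 2)) :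
    ∫ x, u (‖x‖ ^ 2) * (volDensity (radialMetric F hF hpos) x *
        laplaceBeltrami (radialMetric F hF hpos) φ x) =
      ∫ x, φ x * ∑ j, partialDeriv j (fun y => 2 * p (‖y‖ ^ 2) * y j) x := by
  set g := radialMetric F hF hpos with hg
  have hT : ∀ i j, ContDiff ℝ 1 (gradTerm g φ i j) := fun i j =>
    (contDiff_gradTerm hF hpos hφ i j).of_le (by simp)
  have hTc : ∀ i j, HasCompactSupport (gradTerm g φ i j) := hasCompactSupport_gradTerm g hc
  have hφ1 : ContDiff ℝ 1 φ := hφ.of_le (by simp)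
  have hY : ∀ j : Fin 2, ContDiff ℝ 1 fun y : Plane => 2 * p (‖y‖ ^ 2) * y j := fun j =>
    (contDiff_const.mul hP).mul (by fun_prop)
  have hUi : ∀ (i : Fin 2) (x : Plane),
      partialDeriv i (fun x : Plane => u (‖x‖ ^ 2)) x = u₁ (‖x‖ ^ 2) * (2 * x i) := by
    intro i x
    have h := HasPartials.radial (hu₁ x)
    fin_cases i
    · exact h.partialDeriv_zero
    · exact h.partialDeriv_one
  calc
    _ = ∫ x, ∑ i, ∑ j, u (‖x‖ ^ 2) * partialDeriv i (gradTerm g φ i j) x := by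
      refine integral_congr_ae (.of_forall fun x => ?_)
      simp only [hg, volDensity_mul_laplaceBeltrami, Finset.mul_sum]
    _ = ∑ i, ∑ j, ∫ x, u (‖x‖ ^ 2) * partialDeriv i (gradTerm g φ i j) x := by
      rw [integral_finsetSum _ fun i _ => integrable_finsetSum _ fun j _ =>
        integrable_mul_partialDeriv hU.continuous (hT i j) (hTc i j) i]
      refine Finset.sum_congr rfl fun i _ => integral_finsetSum _ fun j _ =>
        integrable_mul_partialDeriv hU.continuous (hT i j) (hTc i j) i
    _ = ∑ i, ∑ j, -∫ x, partialDeriv i (fun x : Plane => u (‖x‖ ^ 2)) x * gradTerm g φ i j x :=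
      Finset.sum_congr rfl fun i _ => Finset.sum_congr rfl fun j _ =>
        integral_mul_partialDeriv hU (hT i j) (hTc i j) i
    _ = -∫ x, ∑ i, ∑ j,
          partialDeriv i (fun x : Plane => u (‖x‖ ^ 2)) x * gradTerm g φ i j x := by
      rw [integral_finsetSum _ fun i _ => integrable_finsetSum _ fun j _ =>
        integrable_partialDeriv_mul hU (hT i j).continuous (hTc i j) i]
      simp only [Finset.sum_neg_distrib]
      congr 1
      refine Finset.sum_congr rfl fun i _ => (integral_finsetSum _ fun j _ =>
        integrable_partialDeriv_mul hU (hT i j).continuous (hTc i j) i).symm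
    -- The Euclidean gradient of `u` is `2u₁x`, which `g⁻¹` fixes, so the weighted gradient is the
    -- field `2p x`; a second integration by parts frees `φ`.
    _ = -∫ x, ∑ j, 2 * p (‖x‖ ^ 2) * x j * partialDeriv j φ x := by
      congr 1
      refine integral_congr_ae (.of_forall fun x => ?_)
      dsimp only
      rw [Finset.sum_comm]
      refine Finset.sum_congr rfl fun j _ => ?_
      rw [hp x, ← sum_mul_inv_gram hF hpos x j, Finset.mul_sum, Finset.sum_mul]
      refine Finset.sum_congr rfl fun i _ => ?_
      rw [hUi, gradTerm]
      ring
    _ = ∑ j, ∫ x, partialDeriv j (fun y => 2 * p (‖y‖ ^ 2) * y j) x * φ x := by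
      rw [integral_finsetSum _ fun j _ =>
        integrable_mul_partialDeriv (hY j).continuous hφ1 hc j, ← Finset.sum_neg_distrib]
      refine Finset.sum_congr rfl fun j _ => ?_
      rw [integral_mul_partialDeriv (hY j) hφ1 hc j, neg_neg]
    _ = _ := by
      rw [← integral_finsetSum _ fun j _ =>
        integrable_partialDeriv_mul (hY j) hφ1.continuous hc j]
      refine integral_congr_ae (.of_forall fun x => ?_)
      dsimp only
      rw [Finset.mul_sum]
      exact Finset.sum_congr rfl fun j _ => mul_comm _ _

lemma sum_partialDeriv_radialField {p : ℝ → ℝ} {p' : ℝ} {x : Plane}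
    (h : HasDerivAt p p' (‖x‖ ^ 2)) :
    ∑ j, partialDeriv j (fun y => 2 * p (‖y‖ ^ 2) * y j) x =
      4 * p (‖x‖ ^ 2) + 4 * ‖x‖ ^ 2 * p' := by
  have h0 := ((hasPartials_const 2 x).mul (HasPartials.radial h)).mul (hasPartials_zero x)
  have h1 := ((hasPartials_const 2 x).mul (HasPartials.radial h)).mul (hasPartials_one x)
  rw [Fin.sum_univ_two, h0.partialDeriv_zero, h1.partialDeriv_one, normSq_eq]
  ring

end WeakLaplacian

/-! ### Smooth convex approximation of the positive part. -/

section ConvexCutoff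

/-- A smooth convex approximation of the positive part, with slope `0` on `(-∞, η]`. -/
def convexCutoff (η s : ℝ) : ℝ := ∫ v in (0 : ℝ)..s, Real.smoothTransition (v / η - 1)

/-- The derivative of `convexCutoff`. -/
def cutoffSlope (η s : ℝ) : ℝ := Real.smoothTransition (s / η - 1)

lemma contDiff_cutoffSlope (η : ℝ) : ContDiff ℝ ∞ (cutoffSlope η) := by
  have h : ContDiff ℝ ∞ fun s : ℝ => s / η - 1 := by fun_prop
  exact Real.smoothTransition.contDiff.comp h

lemma hasDerivAt_convexCutoff (η s : ℝ) : HasDerivAt (convexCutoff η) (cutoffSlope η s) s :=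
  (contDiff_cutoffSlope η).continuous.integral_hasStrictDerivAt 0 s |>.hasDerivAt

lemma contDiff_convexCutoff (η : ℝ) : ContDiff ℝ ∞ (convexCutoff η) := by
  rw [contDiff_infty_iff_deriv]
  refine ⟨fun s => (hasDerivAt_convexCutoff η s).differentiableAt, ?_⟩
  rw [show deriv (convexCutoff η) = cutoffSlope η from
    funext fun s => (hasDerivAt_convexCutoff η s).deriv]
  exact contDiff_cutoffSlope η

variable {η : ℝ}

lemma cutoffSlope_nonneg (s : ℝ) : 0 ≤ cutoffSlope η s := Real.smoothTransition.nonneg _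

lemma cutoffSlope_le_one (s : ℝ) : cutoffSlope η s ≤ 1 := Real.smoothTransition.le_one _

lemma cutoffSlope_monotone (hη : 0 < η) : Monotone (cutoffSlope η) := fun s t h =>
  Real.smoothTransition.monotone (by gcongr)

lemma cutoffSlope_eq_zero (hη : 0 < η) {s : ℝ} (hs : s ≤ η) : cutoffSlope η s = 0 := by
  apply Real.smoothTransition.zero_of_nonpos
  rw [sub_nonpos, div_le_one hη]
  exact hs

lemma cutoffSlope_eq_one (hη : 0 < η) {s : ℝ} (hs : 2 * η ≤ s) : cutoffSlope η s = 1 := by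
  apply Real.smoothTransition.one_of_one_le
  rw [le_sub_iff_add_le, le_div_iff₀ hη]
  linarith

lemma intervalIntegrable_cutoffSlope (η a b : ℝ) :
    IntervalIntegrable (cutoffSlope η) volume a b :=
  (contDiff_cutoffSlope η).continuous.intervalIntegrable a b

lemma convexCutoff_eq_zero (hη : 0 < η) {s : ℝ} (hs : s ≤ η) : convexCutoff η s = 0 := by
  unfold convexCutoff
  rw [intervalIntegral.integral_congr (g := fun _ => (0 : ℝ))]
  · simp
  · intro v hv
    refine cutoffSlope_eq_zero hη (hv.2.trans ?_)
    exact max_le hη.le hs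

lemma convexCutoff_nonneg (hη : 0 < η) (s : ℝ) : 0 ≤ convexCutoff η s := by
  rcases le_total s 0 with hs | hs
  · rw [convexCutoff_eq_zero hη (hs.trans hη.le)]
  · exact intervalIntegral.integral_nonneg hs fun v _ => cutoffSlope_nonneg v

/-- Convexity together with the value `0` at `0`: the slope on `[0, s]` never exceeds its value at
`s`. -/
lemma convexCutoff_le_mul_cutoffSlope (hη : 0 < η) {s : ℝ} (hs : 0 ≤ s) :
    convexCutoff η s ≤ s * cutoffSlope η s := by
  have h := intervalIntegral.integral_mono_on hs (intervalIntegrable_cutoffSlope η 0 s)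
    (intervalIntegrable_const (c := cutoffSlope η s)) fun v hv => cutoffSlope_monotone hη hv.2
  rwa [intervalIntegral.integral_const, sub_zero, smul_eq_mul] at h

lemma convexCutoff_le (hη : 0 < η) (s : ℝ) : convexCutoff η s ≤ max s 0 := by
  rcases le_total s 0 with hs | hs
  · rw [convexCutoff_eq_zero hη (hs.trans hη.le)]
    exact le_max_right _ _
  · exact (convexCutoff_le_mul_cutoffSlope hη hs).trans
      ((mul_le_of_le_one_right hs (cutoffSlope_le_one s)).trans (le_max_left _ _))

/-- The slope is `1` beyond `2η`, so the deficit from the positive part stops growing there. -/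
lemma le_convexCutoff (hη : 0 < η) (s : ℝ) : max s 0 - 2 * η ≤ convexCutoff η s := by
  have h0 := convexCutoff_nonneg hη s
  rcases le_total s (2 * η) with hs | hs
  · have : max s 0 ≤ 2 * η := max_le hs (by linarith)
    linarith
  · have h1 : convexCutoff η s = convexCutoff η (2 * η) + (s - 2 * η) := by
      have h2 := intervalIntegral.integral_add_adjacent_intervals
        (intervalIntegrable_cutoffSlope η 0 (2 * η)) (intervalIntegrable_cutoffSlope η (2 * η) s)
      have h3 : ∫ v in (2 * η)..s, cutoffSlope η v = s - 2 * η := by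
        rw [intervalIntegral.integral_congr (g := fun _ => (1 : ℝ))]
        · simp
        · intro v hv
          rw [uIcc_of_le hs] at hv
          exact cutoffSlope_eq_one hη hv.1
      rw [h3] at h2
      exact h2.symm
    have h2 := convexCutoff_nonneg hη (2 * η)
    rw [max_eq_left (by linarith)]
    linarith

end ConvexCutoff

/-! ### Construction of the warping function and its metric. -/

section Profile

variable {δ : ℝ}

lemma radius_pos (hδ : 0 < δ) : 0 < radius δ := Real.rpow_pos_of_pos (by positivity) _

lemma radius_sq_rpow (hδ : 0 < δ) : (radius δ ^ 2) ^ δ = (2 * (1 + δ) * δ)⁻¹ := by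
  have h : 0 ≤ 2 * (1 + δ) * δ := by positivity
  rw [radius, ← Real.rpow_natCast, ← Real.rpow_mul h, ← Real.rpow_mul h, ← Real.rpow_neg_one]
  congr 1
  push_cast
  field_simp

/-- Leaves room for the interpolation between `t = 1/4` and `t_δ`. Otherwise `16^δ ≤ 2δ + 2δ²`,
whereas `16^δ ≥ e^{2δ} ≥ 1 + 2δ + 2δ²`. -/
lemma lt_radius_sq (hδ : 0 < δ) : 1 / 16 < radius δ ^ 2 := by
  by_contra! h
  have h1 : (radius δ ^ 2) ^ δ ≤ (1 / 16 : ℝ) ^ δ :=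
    Real.rpow_le_rpow (sq_nonneg _) h hδ.le
  rw [radius_sq_rpow hδ, one_div, Real.inv_rpow (by norm_num)] at h1
  have h2 : (16 : ℝ) ^ δ ≤ 2 * (1 + δ) * δ :=
    (inv_le_inv₀ (by positivity) (by positivity)).1 h1
  have h3 : Real.exp (2 * δ) ≤ (16 : ℝ) ^ δ := by
    rw [Real.rpow_def_of_pos (by norm_num)]
    gcongr
    rw [show (16 : ℝ) = 2 ^ 4 by norm_num, Real.log_pow]
    have := Real.log_two_gt_d9
    push_cast
    linarith
  have h4 := Real.quadratic_le_exp_of_nonneg (by positivity : (0 : ℝ) ≤ 2 * δ)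
  nlinarith

/-- The logarithm of `σ(t) / t` near infinity, as a function of `ρ = t²`. -/
def logTail (δ ρ : ℝ) : ℝ := -(1 + δ / 2) * Real.log ρ - ρ ^ (1 + δ)

/-- The logarithm of `σ(t) / t`, as a function of `ρ = t²`. -/
def logProfile (δ ρ : ℝ) : ℝ :=
  Real.smoothTransition ((ρ - 1 / 16) / (radius δ ^ 2 - 1 / 16)) * logTail δ ρ

lemma contDiffAt_logTail {ρ : ℝ} (hρ : 0 < ρ) : ContDiffAt ℝ ∞ (logTail δ) ρ :=
  (contDiffAt_const.mul (Real.contDiffAt_log.2 hρ.ne')).sub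
    (Real.contDiffAt_rpow_const_of_ne hρ.ne')

lemma logProfile_of_le (hδ : 0 < δ) {ρ : ℝ} (hρ : ρ ≤ 1 / 16) : logProfile δ ρ = 0 := by
  rw [logProfile, Real.smoothTransition.zero_of_nonpos, zero_mul]
  exact div_nonpos_of_nonpos_of_nonneg (by linarith) (by linarith [lt_radius_sq hδ])

lemma logProfile_of_ge (hδ : 0 < δ) {ρ : ℝ} (hρ : radius δ ^ 2 ≤ ρ) :
    logProfile δ ρ = logTail δ ρ := by
  rw [logProfile, Real.smoothTransition.one_of_one_le, one_mul]
  rw [one_le_div (by linarith [lt_radius_sq hδ])]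
  linarith

lemma contDiff_logProfile (hδ : 0 < δ) : ContDiff ℝ ∞ (logProfile δ) := by
  rw [contDiff_iff_contDiffAt]
  intro ρ
  rcases lt_or_ge ρ (1 / 16) with hρ | hρ
  · refine (contDiffAt_const (c := (0 : ℝ))).congr_of_eventuallyEq ?_
    filter_upwards [Iio_mem_nhds hρ] with r hr using logProfile_of_le hδ (le_of_lt hr)
  · have h1 : ContDiffAt ℝ ∞
        (fun ρ : ℝ => (ρ - 1 / 16) / (radius δ ^ 2 - 1 / 16)) ρ := by fun_prop
    exact (Real.smoothTransition.contDiffAt.comp ρ h1).mul (contDiffAt_logTail (by linarith))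

/-- The coefficient of `(t² dθ)²` in the metric, as a function of `ρ = t²`. -/
def angularCoeff (δ ρ : ℝ) : ℝ := (Real.exp (2 * logProfile δ ρ) - 1) * ρ⁻¹

lemma one_add_mul_angularCoeff (hδ : 0 < δ) (ρ : ℝ) :
    1 + ρ * angularCoeff δ ρ = Real.exp (2 * logProfile δ ρ) := by
  -- At `ρ = 0` the convention `0⁻¹ = 0` is harmless, because the profile vanishes there.
  rcases eq_or_ne ρ 0 with rfl | hρ
  · rw [logProfile_of_le hδ (by norm_num)]
    simp
  · rw [angularCoeff]
    field_simp
    ring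

/-- The factor `ρ⁻¹` is no singularity: the coefficient is identically zero for `ρ < 1/16`, so the
metric is flat near the pole. -/
lemma contDiff_angularCoeff (hδ : 0 < δ) : ContDiff ℝ ∞ (angularCoeff δ) := by
  rw [contDiff_iff_contDiffAt]
  intro ρ
  rcases lt_or_ge ρ (1 / 16) with hρ | hρ
  · refine (contDiffAt_const (c := (0 : ℝ))).congr_of_eventuallyEq ?_
    filter_upwards [Iio_mem_nhds hρ] with r hr
    rw [angularCoeff, logProfile_of_le hδ (le_of_lt hr)]
    simp
  · refine ContDiffAt.mul ?_ (contDiffAt_inv ℝ (by linarith))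
    exact ((contDiff_const.mul (contDiff_logProfile hδ)).exp.sub contDiff_const).contDiffAt

lemma one_add_mul_angularCoeff_pos (hδ : 0 < δ) (x : Plane) :
    0 < 1 + ‖x‖ ^ 2 * angularCoeff δ (‖x‖ ^ 2) := by
  rw [one_add_mul_angularCoeff hδ]
  exact Real.exp_pos _

/-- The metric of the model surface. -/
def modelMetric (hδ : 0 < δ) : PlaneMetric :=
  radialMetric (angularCoeff δ) (contDiff_angularCoeff hδ) (one_add_mul_angularCoeff_pos hδ)

/-- The warping function of the model surface. -/
def warping (δ t : ℝ) : ℝ := t * Real.exp (logProfile δ (t ^ 2))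

lemma warping_of_lt (hδ : 0 < δ) {t : ℝ} (h0 : 0 < t) (ht : t < 1 / 4) : warping δ t = t := by
  rw [warping, logProfile_of_le hδ (by nlinarith)]
  simp

lemma exp_logTail {ρ : ℝ} (hρ : 0 < ρ) :
    Real.exp (logTail δ ρ) = ρ ^ (-(1 + δ / 2)) * Real.exp (-ρ ^ (1 + δ)) := by
  rw [logTail, sub_eq_add_neg, Real.exp_add, Real.rpow_def_of_pos hρ (-(1 + δ / 2)),
    mul_comm (Real.log ρ)]

lemma sq_rpow {t : ℝ} (ht : 0 ≤ t) (s : ℝ) : (t ^ 2) ^ s = t ^ (2 * s) := by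
  rw [← Real.rpow_natCast, ← Real.rpow_mul ht]
  norm_num

lemma warping_of_gt (hδ : 0 < δ) {t : ℝ} (ht : radius δ < t) :
    warping δ t = Real.exp (-t ^ (2 + 2 * δ)) / t ^ (1 + δ) := by
  have h0 : 0 < t := (radius_pos hδ).trans ht
  rw [warping, logProfile_of_ge hδ (by nlinarith [radius_pos hδ]), exp_logTail (by positivity),
    sq_rpow h0.le, sq_rpow h0.le, div_eq_mul_inv (Real.exp _), ← Real.rpow_neg h0.le,
    show -(1 + δ) = 1 + 2 * -(1 + δ / 2) by ring, Real.rpow_add h0 1, Real.rpow_one,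
    show 2 * (1 + δ) = 2 + 2 * δ by ring]
  ring

lemma isModelMetric_modelMetric (hδ : 0 < δ) : IsModelMetric (modelMetric hδ) (warping δ) := by
  refine isModelMetric_radialMetric _ _ (ContDiff.contDiffOn ?_) (fun t ht => ?_) fun t ht => ?_
  · exact contDiff_id.mul ((contDiff_logProfile hδ).comp (contDiff_id.pow 2)).exp
  · exact mul_pos ht (Real.exp_pos _)
  · rw [one_add_mul_angularCoeff hδ, warping, mul_pow, ← Real.exp_nat_mul]
    norm_num

lemma volDensity_modelMetric (hδ : 0 < δ) (x : Plane) :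
    volDensity (modelMetric hδ) x = Real.exp (logProfile δ (‖x‖ ^ 2)) := by
  rw [modelMetric, volDensity_radialMetric, one_add_mul_angularCoeff hδ, mul_comm, Real.exp_mul,
    Real.rpow_two, Real.sqrt_sq (Real.exp_pos _).le]

end Profile

/-! ### Curvature at infinity. -/

section CurvatureAsymptotics

variable {δ : ℝ}

lemma hasDerivAt_logTail {ρ : ℝ} (hρ : 0 < ρ) :
    HasDerivAt (logTail δ) (-(1 + δ / 2) * ρ⁻¹ - (1 + δ) * ρ ^ δ) ρ := by
  have h := ((Real.hasDerivAt_log hρ.ne').const_mul (-(1 + δ / 2))).sub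
    (Real.hasDerivAt_rpow_const (p := 1 + δ) (Or.inl hρ.ne'))
  rwa [add_sub_cancel_left] at h

lemma hasDerivAt_deriv_logTail {ρ : ℝ} (hρ : 0 < ρ) :
    HasDerivAt (fun ρ => -(1 + δ / 2) * ρ⁻¹ - (1 + δ) * ρ ^ δ)
      ((1 + δ / 2) * (ρ ^ 2)⁻¹ - (1 + δ) * (δ * ρ ^ (δ - 1))) ρ := by
  have h := ((hasDerivAt_inv hρ.ne').const_mul (-(1 + δ / 2))).sub
    ((Real.hasDerivAt_rpow_const (p := δ) (Or.inl hρ.ne')).const_mul (1 + δ))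
  exact h.congr_deriv (by ring)

lemma eventually_one_add_mul_angularCoeff (hδ : 0 < δ) {ρ : ℝ} (hρ : radius δ ^ 2 < ρ) :
    (fun ρ => 1 + ρ * angularCoeff δ ρ) =ᶠ[𝓝 ρ] fun ρ => Real.exp (2 * logTail δ ρ) := by
  filter_upwards [Ioi_mem_nhds hρ] with r hr
  rw [one_add_mul_angularCoeff hδ, logProfile_of_ge hδ (le_of_lt hr)]

lemma gaussianCurvature_modelMetric (hδ : 0 < δ) {x : Plane} (hx : radius δ ^ 2 < ‖x‖ ^ 2) :
    gaussianCurvature (modelMetric hδ) x =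
      -(4 * (1 + δ) ^ 2 * (‖x‖ ^ 2) ^ (1 + 2 * δ) + (2 + δ) * (1 + δ) * (‖x‖ ^ 2)⁻¹
        + 2 * (1 + δ) * (‖x‖ ^ 2) ^ δ) := by
  have hF := contDiff_angularCoeff hδ
  have hF' : ContDiff ℝ ∞ (deriv (angularCoeff δ)) := (contDiff_infty_iff_deriv.1 hF).2
  have hF₁ : ∀ ρ, HasDerivAt (angularCoeff δ) (deriv (angularCoeff δ) ρ) ρ := fun ρ =>
    (hF.differentiable (by simp) ρ).hasDerivAt
  have hF₂ : ∀ ρ, HasDerivAt (deriv (angularCoeff δ)) (deriv (deriv (angularCoeff δ)) ρ) ρ :=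
    fun ρ => (hF'.differentiable (by simp) ρ).hasDerivAt
  rw [modelMetric, gaussianCurvature_radialMetric _ _ hF₁ hF₂ x rfl rfl rfl rfl]
  generalize ‖x‖ ^ 2 = ρ at *
  have hρ : 0 < ρ := (sq_nonneg _).trans_lt hx
  -- The derivatives of `1 + ρF` come from uniqueness of the derivative against `e^{2 logTail}`. The
  -- identity is needed on a whole half-line so that it can be differentiated once more.
  have hD₁ : ∀ r, radius δ ^ 2 < r → angularCoeff δ r + r * deriv (angularCoeff δ) r =
      Real.exp (2 * logTail δ r) * (2 * (-(1 + δ / 2) * r⁻¹ - (1 + δ) * r ^ δ)) := by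
    intro r hr
    have hr0 : 0 < r := (sq_nonneg _).trans_lt hr
    have h1 := ((hasDerivAt_id r).mul (hF₁ r)).const_add 1
    have h2 := ((hasDerivAt_logTail (δ := δ) hr0).const_mul 2).exp
    have h3 := h1.unique (h2.congr_of_eventuallyEq (eventually_one_add_mul_angularCoeff hδ hr))
    simpa using h3
  have hD₂ : 2 * deriv (angularCoeff δ) ρ + ρ * deriv (deriv (angularCoeff δ)) ρ =
      Real.exp (2 * logTail δ ρ) * ((2 * (-(1 + δ / 2) * ρ⁻¹ - (1 + δ) * ρ ^ δ)) ^ 2 +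
        2 * ((1 + δ / 2) * (ρ ^ 2)⁻¹ - (1 + δ) * (δ * ρ ^ (δ - 1)))) := by
    have h1 := (hF₁ ρ).add ((hasDerivAt_id ρ).mul (hF₂ ρ))
    have h2 := ((hasDerivAt_logTail (δ := δ) hρ).const_mul 2).exp.mul
      ((hasDerivAt_deriv_logTail (δ := δ) hρ).const_mul 2)
    have h3 := h1.unique (h2.congr_of_eventuallyEq (by
      filter_upwards [Ioi_mem_nhds hx] with r hr using hD₁ r hr))
    simp only [id_eq] at h3
    linear_combination h3
  rw [hD₁ ρ hx, hD₂, (eventually_one_add_mul_angularCoeff hδ hx).eq_of_nhds]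
  have hE := (Real.exp_pos (2 * logTail δ ρ)).ne'
  have hp : ρ ^ (δ - 1) = ρ ^ δ * ρ⁻¹ := by rw [Real.rpow_sub hρ, Real.rpow_one, div_eq_mul_inv]
  have hq : ρ ^ (1 + 2 * δ) = ρ * (ρ ^ δ) ^ 2 := by
    rw [Real.rpow_add hρ, Real.rpow_one, ← Real.rpow_natCast, ← Real.rpow_mul hρ.le]
    norm_num [mul_comm]
  rw [hp, hq]
  generalize ρ ^ δ = s
  field_simp
  ring

lemma isEquivalent_gaussianCurvature (hδ : 0 < δ) :
    Asymptotics.IsEquivalent (cocompact Plane) (gaussianCurvature (modelMetric hδ))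
      (fun x => -(4 * (1 + δ) ^ 2) * ‖x‖ ^ (2 + 4 * δ)) := by
  have hN : Tendsto (fun x : Plane => ‖x‖ ^ 2) (cocompact Plane) atTop :=
    (tendsto_pow_atTop two_ne_zero).comp tendsto_norm_cocompact_atTop
  -- This is the curvature divided by its leading term `-4(1+δ)² ρ^{1+2δ}`.
  have hlim : Tendsto (fun ρ : ℝ => 1 + (2 + δ) * (1 + δ) / (4 * (1 + δ) ^ 2) * ρ ^ (-(2 + 2 * δ)) +
      2 * (1 + δ) / (4 * (1 + δ) ^ 2) * ρ ^ (-(1 + δ))) atTop (𝓝 1) := by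
    have h1 := (tendsto_rpow_neg_atTop (by linarith : 0 < 2 + 2 * δ)).const_mul
      ((2 + δ) * (1 + δ) / (4 * (1 + δ) ^ 2))
    have h2 := (tendsto_rpow_neg_atTop (by linarith : 0 < 1 + δ)).const_mul
      (2 * (1 + δ) / (4 * (1 + δ) ^ 2))
    simpa using (h1.const_add 1).add h2
  have hev := hN.eventually_gt_atTop (radius δ ^ 2)
  have hne : ∀ᶠ x : Plane in cocompact Plane, -(4 * (1 + δ) ^ 2) * ‖x‖ ^ (2 + 4 * δ) ≠ 0 := by
    filter_upwards [hev] with x hx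
    have h0 : ‖x‖ ≠ 0 := fun h => by
      rw [h] at hx
      nlinarith [sq_nonneg (radius δ)]
    have : 0 < ‖x‖ ^ (2 + 4 * δ) := Real.rpow_pos_of_pos (lt_of_le_of_ne (norm_nonneg x) h0.symm) _
    exact mul_ne_zero (neg_ne_zero.2 (by positivity)) this.ne'
  rw [Asymptotics.isEquivalent_iff_tendsto_one hne]
  refine (hlim.comp hN).congr' ?_
  filter_upwards [hev] with x hx
  have hρ : 0 < ‖x‖ ^ 2 := (sq_nonneg _).trans_lt hx
  rw [Function.comp, Pi.div_apply, gaussianCurvature_modelMetric hδ hx,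
    show 2 + 4 * δ = 2 * (1 + 2 * δ) by ring, ← sq_rpow (norm_nonneg x)]
  generalize ‖x‖ ^ 2 = ρ at *
  rw [show -(2 + 2 * δ) = -1 - (1 + 2 * δ) by ring, show -(1 + δ) = δ - (1 + 2 * δ) by ring,
    Real.rpow_sub hρ, Real.rpow_sub hρ, Real.rpow_neg_one]
  have hq := (Real.rpow_pos_of_pos hρ (1 + 2 * δ)).ne'
  have hd : (1 + δ) ≠ 0 := by positivity
  field_simp

end CurvatureAsymptotics

/-! ### The pointwise inequality for the regularised witness. -/

section Witness

variable {δ : ℝ}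

/-- The function `e^(ρ^(1 + δ)) - e^(ρ₀^(1 + δ))` of `ρ = t²`, where `ρ₀ = t_δ²`. -/
def expGap (δ ρ : ℝ) : ℝ := Real.exp (ρ ^ (1 + δ)) - Real.exp ((radius δ ^ 2) ^ (1 + δ))

/-- The derivative of `expGap`. -/
def expGapDeriv (δ ρ : ℝ) : ℝ := Real.exp (ρ ^ (1 + δ)) * ((1 + δ) * ρ ^ δ)

lemma witness_eq (hδ : 0 < δ) (x : Plane) : witness δ x = -max (expGap δ (‖x‖ ^ 2)) 0 := by
  rw [witness, expGap, sq_rpow (norm_nonneg x), sq_rpow (radius_pos hδ).le,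
    show 2 * (1 + δ) = 2 + 2 * δ by ring]

lemma hasDerivAt_expGap (hδ : 0 < δ) (ρ : ℝ) : HasDerivAt (expGap δ) (expGapDeriv δ ρ) ρ := by
  have h := (Real.hasDerivAt_rpow_const (x := ρ) (p := 1 + δ) (Or.inr (by linarith))).exp.sub_const
    (Real.exp ((radius δ ^ 2) ^ (1 + δ)))
  rwa [add_sub_cancel_left] at h

lemma continuous_expGap (hδ : 0 < δ) : Continuous (expGap δ) :=
  continuous_iff_continuousAt.2 fun ρ => (hasDerivAt_expGap hδ ρ).continuousAt

lemma contDiffAt_expGap {ρ : ℝ} (hρ : 0 < ρ) : ContDiffAt ℝ ∞ (expGap δ) ρ :=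
  (Real.contDiffAt_rpow_const_of_ne hρ.ne').exp.sub contDiffAt_const

lemma contDiffAt_expGapDeriv {ρ : ℝ} (hρ : 0 < ρ) : ContDiffAt ℝ ∞ (expGapDeriv δ) ρ :=
  (Real.contDiffAt_rpow_const_of_ne hρ.ne').exp.mul
    (contDiffAt_const.mul (Real.contDiffAt_rpow_const_of_ne hρ.ne'))

lemma expGap_nonpos (hδ : 0 < δ) {ρ : ℝ} (h0 : 0 ≤ ρ) (hρ : ρ ≤ radius δ ^ 2) :
    expGap δ ρ ≤ 0 := by
  rw [expGap, sub_nonpos]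
  gcongr

lemma expGap_pos (hδ : 0 < δ) {ρ : ℝ} (hρ : radius δ ^ 2 < ρ) : 0 < expGap δ ρ := by
  rw [expGap, sub_pos]
  have := sq_nonneg (radius δ)
  gcongr

lemma contDiffAt_comp_normSq {u : ℝ → ℝ} {x : Plane} (hu : ContDiffAt ℝ ∞ u (‖x‖ ^ 2)) :
    ContDiffAt ℝ 1 (fun x : Plane => u (‖x‖ ^ 2)) x :=
  (hu.comp x (contDiff_norm_sq ℝ).contDiffAt).of_le (by simp)

lemma eventually_expGap_lt (hδ : 0 < δ) {η ρ : ℝ} (h : expGap δ ρ < η) :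
    ∀ᶠ r in 𝓝 ρ, expGap δ r < η :=
  (continuous_expGap hδ).continuousAt.eventually_lt continuousAt_const h

/-- The power `ρ^{1+δ}` need not be smooth at `0`, but the gap is nonpositive at the pole and the
cutoff vanishes up to `η > 0`, so the composite is zero near it. -/
lemma contDiff_convexCutoff_expGap (hδ : 0 < δ) {η : ℝ} (hη : 0 < η) :
    ContDiff ℝ 1 fun x : Plane => convexCutoff η (expGap δ (‖x‖ ^ 2)) := by
  refine contDiff_iff_contDiffAt.2 fun x =>
    contDiffAt_comp_normSq (u := fun ρ => convexCutoff η (expGap δ ρ)) ?_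
  rcases (sq_nonneg ‖x‖).eq_or_lt with h | h
  · have h0 : expGap δ (‖x‖ ^ 2) < η :=
      (expGap_nonpos hδ (sq_nonneg _) (h ▸ sq_nonneg _)).trans_lt hη
    refine (contDiffAt_const (c := (0 : ℝ))).congr_of_eventuallyEq ?_
    filter_upwards [eventually_expGap_lt hδ h0] with r hr using convexCutoff_eq_zero hη hr.le
  · exact (contDiff_convexCutoff η).contDiffAt.comp _ (contDiffAt_expGap h)

/-- The radial flux `√(det g) du/dρ` of `u = convexCutoff η ∘ expGap δ`. -/
def cutoffFlux (δ η ρ : ℝ) : ℝ :=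
  Real.exp (logProfile δ ρ) * (cutoffSlope η (expGap δ ρ) * expGapDeriv δ ρ)

lemma cutoffFlux_eq_zero {η ρ : ℝ} (hη : 0 < η) (h : expGap δ ρ ≤ η) : cutoffFlux δ η ρ = 0 := by
  rw [cutoffFlux, cutoffSlope_eq_zero hη h]
  simp

lemma contDiff_cutoffFlux (hδ : 0 < δ) {η : ℝ} (hη : 0 < η) :
    ContDiff ℝ 1 fun x : Plane => cutoffFlux δ η (‖x‖ ^ 2) := by
  refine contDiff_iff_contDiffAt.2 fun x => contDiffAt_comp_normSq ?_
  rcases (sq_nonneg ‖x‖).eq_or_lt with h | h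
  · have h0 : expGap δ (‖x‖ ^ 2) < η :=
      (expGap_nonpos hδ (sq_nonneg _) (h ▸ sq_nonneg _)).trans_lt hη
    refine (contDiffAt_const (c := (0 : ℝ))).congr_of_eventuallyEq ?_
    filter_upwards [eventually_expGap_lt hδ h0] with r hr using cutoffFlux_eq_zero hη hr.le
  · exact (contDiff_logProfile hδ).exp.contDiffAt.mul
      (((contDiff_cutoffSlope η).contDiffAt.comp _ (contDiffAt_expGap h)).mul
        (contDiffAt_expGapDeriv h))

/-- The exact cancellation between the growth of the witness and the decay of the volume density. It
drives both the flux computation and integrability. -/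
lemma exp_logProfile_mul_exp (hδ : 0 < δ) {ρ : ℝ} (hρ : radius δ ^ 2 < ρ) :
    Real.exp (logProfile δ ρ) * Real.exp (ρ ^ (1 + δ)) = ρ ^ (-(1 + δ / 2)) := by
  have h0 : 0 < ρ := (sq_nonneg _).trans_lt hρ
  rw [logProfile_of_ge hδ hρ.le, exp_logTail h0, mul_assoc, ← Real.exp_add, neg_add_cancel,
    Real.exp_zero, mul_one]

lemma cutoffFlux_of_gt (hδ : 0 < δ) (η : ℝ) {ρ : ℝ} (hρ : radius δ ^ 2 < ρ) :
    cutoffFlux δ η ρ = cutoffSlope η (expGap δ ρ) * ((1 + δ) * ρ ^ (δ / 2 - 1)) := by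
  have h0 : 0 < ρ := (sq_nonneg _).trans_lt hρ
  rw [cutoffFlux, expGapDeriv, show δ / 2 - 1 = -(1 + δ / 2) + δ by ring,
    Real.rpow_add h0 (-(1 + δ / 2)),
    ← exp_logProfile_mul_exp hδ hρ]
  ring

/-- The approximation `u = convexCutoff η ∘ expGap δ` satisfies `Δ u ≥ u`. -/
lemma le_div_cutoffFlux (hδ : 0 < δ) {η : ℝ} (hη : 0 < η) (x : Plane) :
    Real.exp (logProfile δ (‖x‖ ^ 2)) * convexCutoff η (expGap δ (‖x‖ ^ 2)) ≤
      ∑ j, partialDeriv j (fun y => 2 * cutoffFlux δ η (‖y‖ ^ 2) * y j) x := by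
  rcases le_or_gt (‖x‖ ^ 2) (radius δ ^ 2) with hx | hx
  · have h0 := (expGap_nonpos hδ (sq_nonneg _) hx).trans_lt hη
    have h1 : HasDerivAt (cutoffFlux δ η) 0 (‖x‖ ^ 2) := by
      refine (hasDerivAt_const _ (0 : ℝ)).congr_of_eventuallyEq ?_
      filter_upwards [eventually_expGap_lt hδ h0] with r hr using cutoffFlux_eq_zero hη hr.le
    rw [sum_partialDeriv_radialField h1, cutoffFlux_eq_zero hη h0.le,
      convexCutoff_eq_zero hη h0.le]
    simp
  · obtain ⟨s', hs', hs⟩ : ∃ s', 0 ≤ s' ∧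
        HasDerivAt (cutoffSlope η) s' (expGap δ (‖x‖ ^ 2)) := by
      refine ⟨_, (cutoffSlope_monotone hη).deriv_nonneg,
        ((contDiff_cutoffSlope η).differentiable (by simp) _).hasDerivAt⟩
    have hgap := expGap_pos hδ hx
    have hle := convexCutoff_le_mul_cutoffSlope hη hgap.le
    have hE := exp_logProfile_mul_exp hδ hx
    have hgap' : expGap δ (‖x‖ ^ 2) ≤ Real.exp ((‖x‖ ^ 2) ^ (1 + δ)) :=
      sub_le_self _ (Real.exp_pos _).le
    have hfl := cutoffFlux_of_gt hδ η hx
    have hs0 : 0 ≤ cutoffSlope η (expGap δ (‖x‖ ^ 2)) := cutoffSlope_nonneg _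
    have hd := hasDerivAt_expGap hδ (‖x‖ ^ 2)
    have hρ : 0 < ‖x‖ ^ 2 := (sq_nonneg _).trans_lt hx
    have h1 := ((hs.comp _ hd).mul ((Real.hasDerivAt_rpow_const (p := δ / 2 - 1)
      (Or.inl hρ.ne')).const_mul (1 + δ))).congr_of_eventuallyEq
        (f₁ := cutoffFlux δ η) (by
          filter_upwards [Ioi_mem_nhds hx] with r hr using cutoffFlux_of_gt hδ η hr)
    rw [sum_partialDeriv_radialField h1, hfl]
    -- The only place in this inequality where the specific value of `t_δ` matters.
    have hr : 1 ≤ 2 * (1 + δ) * δ * (‖x‖ ^ 2) ^ δ := by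
      have h2 : (radius δ ^ 2) ^ δ ≤ (‖x‖ ^ 2) ^ δ :=
        Real.rpow_le_rpow (sq_nonneg _) hx.le hδ.le
      rw [radius_sq_rpow hδ] at h2
      rwa [inv_le_iff_one_le_mul₀ (by positivity), mul_comm] at h2
    have hd0 : 0 ≤ expGapDeriv δ (‖x‖ ^ 2) := by
      unfold expGapDeriv
      positivity
    have hp : (‖x‖ ^ 2) ^ (δ / 2 - 1) = (‖x‖ ^ 2) ^ (-(1 + δ / 2)) * (‖x‖ ^ 2) ^ δ := by
      rw [← Real.rpow_add hρ]
      ring_nf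
    have hp' : ‖x‖ ^ 2 * (‖x‖ ^ 2) ^ (δ / 2 - 1 - 1) = (‖x‖ ^ 2) ^ (δ / 2 - 1) := by
      rw [Real.rpow_sub_one hρ.ne', mul_div_cancel₀ _ hρ.ne']
    have hm0 : 0 ≤ (‖x‖ ^ 2) ^ (-(1 + δ / 2)) := by positivity
    calc
      _ ≤ Real.exp (logProfile δ (‖x‖ ^ 2)) * (Real.exp ((‖x‖ ^ 2) ^ (1 + δ)) *
          cutoffSlope η (expGap δ (‖x‖ ^ 2))) := by
        gcongr
        exact hle.trans (by gcongr)
      _ = cutoffSlope η (expGap δ (‖x‖ ^ 2)) * (‖x‖ ^ 2) ^ (-(1 + δ / 2)) * 1 := by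
        rw [← hE]
        ring
      _ ≤ cutoffSlope η (expGap δ (‖x‖ ^ 2)) * (‖x‖ ^ 2) ^ (-(1 + δ / 2)) *
          (2 * (1 + δ) * δ * (‖x‖ ^ 2) ^ δ) := by gcongr
      _ = cutoffSlope η (expGap δ (‖x‖ ^ 2)) * (2 * (1 + δ) * δ) *
          (‖x‖ ^ 2) ^ (δ / 2 - 1) := by
        rw [hp]
        ring
      -- The added term is the contribution of `Ψ''(u)|∇u|²`, nonnegative by convexity.
      _ ≤ cutoffSlope η (expGap δ (‖x‖ ^ 2)) * (2 * (1 + δ) * δ) * (‖x‖ ^ 2) ^ (δ / 2 - 1) +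
          4 * ‖x‖ ^ 2 * (s' * expGapDeriv δ (‖x‖ ^ 2) *
            ((1 + δ) * (‖x‖ ^ 2) ^ (δ / 2 - 1))) := by
        refine le_add_of_nonneg_right ?_
        positivity
      _ = _ := by
        simp only [Function.comp]
        linear_combination (-4 * cutoffSlope η (expGap δ (‖x‖ ^ 2)) * (1 + δ) *
          (δ / 2 - 1)) * hp'

end Witness

/-! ### The distributional inequality, integrability and failure of positivity. -/

section DistributionalInequality

variable {δ : ℝ}

lemma measurable_volDensity (hδ : 0 < δ) : Measurable (volDensity (modelMetric hδ)) :=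
  (contDiff_volDensity _ _).continuous.measurable

lemma volDensity_modelMetric_pos (hδ : 0 < δ) (x : Plane) : 0 < volDensity (modelMetric hδ) x :=
  volDensity_pos _ _ x

lemma integral_riemannianMeasure (hδ : 0 < δ) (k : Plane → ℝ) :
    ∫ x, k x ∂(riemannianMeasure (modelMetric hδ)) =
      ∫ x, volDensity (modelMetric hδ) x * k x := by
  rw [riemannianMeasure, integral_withDensity_eq_integral_toReal_smul
    (measurable_volDensity hδ).ennreal_ofReal (.of_forall fun x => ENNReal.ofReal_lt_top)]
  refine integral_congr_ae (.of_forall fun x => ?_)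
  simp only [smul_eq_mul]
  rw [ENNReal.toReal_ofReal (volDensity_modelMetric_pos hδ x).le]

lemma continuous_witness (hδ : 0 < δ) : Continuous (witness δ) := by
  rw [show witness δ = fun x => -max (expGap δ (‖x‖ ^ 2)) 0 from funext (witness_eq hδ)]
  exact (((continuous_expGap hδ).comp (continuous_norm.pow 2)).max continuous_const).neg

/-- `√(det g) (-Δ φ + φ)`. -/
def weightedOperator (g : PlaneMetric) (φ : Plane → ℝ) (x : Plane) : ℝ :=
  volDensity g x * (-laplaceBeltrami g φ x + φ x)

lemma weightedOperator_eq (hδ : 0 < δ) (φ : Plane → ℝ) (x : Plane) :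
    weightedOperator (modelMetric hδ) φ x =
      -(∑ i, ∑ j, partialDeriv i (gradTerm (modelMetric hδ) φ i j) x) +
        volDensity (modelMetric hδ) x * φ x := by
  rw [weightedOperator, mul_add, mul_neg, modelMetric, volDensity_mul_laplaceBeltrami]

lemma continuous_weightedOperator (hδ : 0 < δ) {φ : Plane → ℝ} (hφ : ContDiff ℝ ∞ φ) :
    Continuous (weightedOperator (modelMetric hδ) φ) := by
  rw [show weightedOperator (modelMetric hδ) φ = _ from funext (weightedOperator_eq hδ φ)]
  refine Continuous.add (Continuous.neg ?_)
    ((contDiff_volDensity _ _).continuous.mul hφ.continuous)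
  exact continuous_finsetSum _ fun i _ => continuous_finsetSum _ fun j _ =>
    (contDiff_partialDeriv (contDiff_gradTerm _ _ hφ i j) (m := 0) (by simp) i).continuous

lemma hasCompactSupport_weightedOperator (hδ : 0 < δ) {φ : Plane → ℝ}
    (hc : HasCompactSupport φ) : HasCompactSupport (weightedOperator (modelMetric hδ) φ) := by
  rw [show weightedOperator (modelMetric hδ) φ = _ from funext (weightedOperator_eq hδ φ)]
  simp only [Fin.sum_univ_two]
  have h : ∀ i j, HasCompactSupport (partialDeriv i (gradTerm (modelMetric hδ) φ i j)) :=
    fun i j => hasCompactSupport_partialDeriv (hasCompactSupport_gradTerm _ hc i j) i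
  exact (((h 0 0).add (h 0 1)).add ((h 1 0).add (h 1 1))).neg.add hc.mul_left

lemma integral_convexCutoff_mul_weightedOperator_nonpos (hδ : 0 < δ) {η : ℝ} (hη : 0 < η)
    {φ : Plane → ℝ} (hφ : ContDiff ℝ ∞ φ) (hc : HasCompactSupport φ) (h0 : ∀ x, 0 ≤ φ x) :
    ∫ x, convexCutoff η (expGap δ (‖x‖ ^ 2)) * weightedOperator (modelMetric hδ) φ x ≤ 0 := by
  have hU := contDiff_convexCutoff_expGap hδ hη
  have hP := contDiff_cutoffFlux hδ hη
  have hY : ∀ j : Fin 2, ContDiff ℝ 1 fun y : Plane => 2 * cutoffFlux δ η (‖y‖ ^ 2) * y j :=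
    fun j => (contDiff_const.mul hP).mul (by fun_prop)
  have key := integral_radial_mul_laplaceBeltrami (contDiff_angularCoeff hδ)
    (one_add_mul_angularCoeff_pos hδ) hφ hc (u := fun ρ => convexCutoff η (expGap δ ρ))
    (u₁ := fun ρ => cutoffSlope η (expGap δ ρ) * expGapDeriv δ ρ) (p := cutoffFlux δ η) hU
    (fun x => (hasDerivAt_convexCutoff η _).comp _ (hasDerivAt_expGap hδ _)) hP (fun x => by
      change _ = volDensity (modelMetric hδ) x * _
      rw [volDensity_modelMetric]
      rfl)
  change ∫ x, convexCutoff η (expGap δ (‖x‖ ^ 2)) * (volDensity (modelMetric hδ) x *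
    laplaceBeltrami (modelMetric hδ) φ x) = _ at key
  have hvc : Continuous (volDensity (modelMetric hδ)) := (contDiff_volDensity _ _).continuous
  have hI1 : Integrable fun x => convexCutoff η (expGap δ (‖x‖ ^ 2)) *
      (volDensity (modelMetric hδ) x * φ x) :=
    (hU.continuous.mul (hvc.mul hφ.continuous)).integrable_of_hasCompactSupport
      (hc.mul_left.mul_left)
  have hI2 : Integrable fun x => convexCutoff η (expGap δ (‖x‖ ^ 2)) *
      weightedOperator (modelMetric hδ) φ x :=
    (hU.continuous.mul (continuous_weightedOperator hδ hφ)).integrable_of_hasCompactSupport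
      (hasCompactSupport_weightedOperator hδ hc).mul_left
  have hI3 : Integrable fun x => convexCutoff η (expGap δ (‖x‖ ^ 2)) *
      (volDensity (modelMetric hδ) x * laplaceBeltrami (modelMetric hδ) φ x) := by
    -- The Laplacian part is the difference of two integrands already known to be integrable.
    refine (hI1.sub hI2).congr (.of_forall fun x => ?_)
    simp only [Pi.sub_apply, weightedOperator]
    ring
  have hI4 : Integrable fun x => φ x *
      ∑ j, partialDeriv j (fun y => 2 * cutoffFlux δ η (‖y‖ ^ 2) * y j) x :=
    (hφ.continuous.mul (continuous_finsetSum _ fun j _ =>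
      (contDiff_partialDeriv (hY j) (m := 0) (by simp) j).continuous)).integrable_of_hasCompactSupport
      hc.mul_right
  have h1 : ∫ x, convexCutoff η (expGap δ (‖x‖ ^ 2)) * weightedOperator (modelMetric hδ) φ x =
      (∫ x, convexCutoff η (expGap δ (‖x‖ ^ 2)) * (volDensity (modelMetric hδ) x * φ x)) -
        ∫ x, convexCutoff η (expGap δ (‖x‖ ^ 2)) *
          (volDensity (modelMetric hδ) x * laplaceBeltrami (modelMetric hδ) φ x) := by
    rw [← integral_sub hI1 hI3]
    refine integral_congr_ae (.of_forall fun x => ?_)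
    simp only [weightedOperator]
    ring
  rw [h1, key, sub_nonpos]
  refine integral_mono hI1 hI4 fun x => ?_
  have h2 := mul_le_mul_of_nonneg_left (le_div_cutoffFlux hδ hη x) (h0 x)
  rw [← volDensity_modelMetric hδ] at h2
  dsimp only
  linarith

/-- The cutoffs differ from the positive part by at most `2η` uniformly, and the weighted operator
applied to `φ` is integrable, so the inequality survives `η → 0`. -/
lemma integral_witness_mul_nonneg (hδ : 0 < δ) {φ : Plane → ℝ} (hφ : ContDiff ℝ ∞ φ)
    (hc : HasCompactSupport φ) (h0 : ∀ x, 0 ≤ φ x) :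
    0 ≤ ∫ x, witness δ x * weightedOperator (modelMetric hδ) φ x := by
  have hk := continuous_weightedOperator hδ hφ
  have hkc := hasCompactSupport_weightedOperator hδ hc
  have hI1 : Integrable fun x => witness δ x * weightedOperator (modelMetric hδ) φ x :=
    ((continuous_witness hδ).mul hk).integrable_of_hasCompactSupport hkc.mul_left
  have hI2 : Integrable fun x => |weightedOperator (modelMetric hδ) φ x| :=
    (hk.integrable_of_hasCompactSupport hkc).abs
  have key : ∀ η : ℝ, 0 < η →
      -(2 * η) * ∫ x, |weightedOperator (modelMetric hδ) φ x| ≤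
        ∫ x, witness δ x * weightedOperator (modelMetric hδ) φ x := by
    intro η hη
    have hI3 : Integrable fun x => convexCutoff η (expGap δ (‖x‖ ^ 2)) *
        weightedOperator (modelMetric hδ) φ x :=
      ((contDiff_convexCutoff_expGap hδ hη).continuous.mul hk).integrable_of_hasCompactSupport
        hkc.mul_left
    have h1 := integral_convexCutoff_mul_weightedOperator_nonpos hδ hη hφ hc h0
    have h2 := integral_mono ((hI2.const_mul (-(2 * η))).sub hI3) hI1 fun x => by
      have ha := convexCutoff_le hη (expGap δ (‖x‖ ^ 2))
      have hb := le_convexCutoff hη (expGap δ (‖x‖ ^ 2))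
      simp only [Pi.sub_apply]
      rw [witness_eq hδ]
      rcases abs_cases (weightedOperator (modelMetric hδ) φ x) with ⟨h, h'⟩ | ⟨h, h'⟩ <;>
        rw [h] <;> nlinarith
    rw [integral_sub' (hI2.const_mul (-(2 * η))) hI3, integral_const_mul] at h2
    linarith
  have hlim : Tendsto (fun η : ℝ => -(2 * η) * ∫ x, |weightedOperator (modelMetric hδ) φ x|)
      (𝓝[>] 0) (𝓝 0) := by
    have h : Continuous fun η : ℝ => -(2 * η) * ∫ x, |weightedOperator (modelMetric hδ) φ x| := by
      fun_prop
    simpa using (h.tendsto 0).mono_left nhdsWithin_le_nhds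
  exact le_of_tendsto hlim (by filter_upwards [self_mem_nhdsWithin] with η hη using key η hη)

lemma integrable_volDensity_mul_witness (hδ : 0 < δ) :
    Integrable fun x => volDensity (modelMetric hδ) x * witness δ x := by
  have hr : (Module.finrank ℝ Plane : ℝ) < 2 + δ := by
    simp [hδ]
  -- Off the disc of radius `t_δ` the product is at most `‖x‖^{-(2+δ)}`, integrable at infinity in
  -- dimension two. The constant comes from `1 + ‖x‖ ≤ (1 + t_δ⁻¹)‖x‖`, valid there.
  refine ((integrable_one_add_norm (E := Plane) (μ := volume) hr).const_mul
    ((1 + (radius δ)⁻¹) ^ (2 + δ))).mono'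
    ((contDiff_volDensity _ _).continuous.mul (continuous_witness hδ)).aestronglyMeasurable
    (.of_forall fun x => ?_)
  have ht := radius_pos hδ
  have hpos : 0 < (1 + (radius δ)⁻¹) ^ (2 + δ) * (1 + ‖x‖) ^ (-(2 + δ)) := by positivity
  rw [witness_eq hδ, mul_neg, norm_neg, norm_mul, Real.norm_eq_abs, Real.norm_eq_abs,
    volDensity_modelMetric, abs_of_pos (Real.exp_pos _), abs_of_nonneg (le_max_right _ _)]
  rcases le_or_gt (‖x‖ ^ 2) (radius δ ^ 2) with hx | hx
  · rw [max_eq_right (expGap_nonpos hδ (sq_nonneg _) hx), mul_zero]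
    exact hpos.le
  · have hx' : radius δ < ‖x‖ := lt_of_pow_lt_pow_left₀ 2 (norm_nonneg x) hx
    have hx0 : 0 < ‖x‖ := ht.trans hx'
    rw [max_eq_left (expGap_pos hδ hx).le]
    calc
      _ ≤ Real.exp (logProfile δ (‖x‖ ^ 2)) * Real.exp ((‖x‖ ^ 2) ^ (1 + δ)) := by
        gcongr
        exact sub_le_self _ (Real.exp_pos _).le
      _ = ‖x‖ ^ (-(2 + δ)) := by
        rw [exp_logProfile_mul_exp hδ hx, sq_rpow hx0.le]
        ring_nf
      _ ≤ _ := by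
        rw [Real.rpow_neg hx0.le, Real.rpow_neg (by positivity), ← div_eq_mul_inv,
          ← Real.div_rpow (by positivity) (by positivity), ← Real.inv_rpow hx0.le]
        refine Real.rpow_le_rpow (by positivity) ?_ (by linarith)
        rw [le_div_iff₀ (by positivity), mul_add, inv_mul_cancel₀ hx0.ne', mul_one, add_comm]
        gcongr

lemma integrable_witness (hδ : 0 < δ) :
    Integrable (witness δ) (riemannianMeasure (modelMetric hδ)) := by
  rw [riemannianMeasure, integrable_withDensity_iff_integrable_smul'
    (measurable_volDensity hδ).ennreal_ofReal (.of_forall fun x => ENNReal.ofReal_lt_top)]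
  refine (integrable_volDensity_mul_witness hδ).congr (.of_forall fun x => ?_)
  simp only [smul_eq_mul]
  rw [ENNReal.toReal_ofReal (volDensity_modelMetric_pos hδ x).le]

lemma distribNonneg_witness (hδ : 0 < δ) : DistribNonneg (modelMetric hδ) (witness δ) := by
  refine ⟨(integrable_witness hδ).locallyIntegrable, fun φ hφ hc h0 => ?_⟩
  rw [integral_riemannianMeasure]
  refine (integral_witness_mul_nonneg hδ hφ hc h0).trans_eq
    (integral_congr_ae (.of_forall fun x => ?_))
  simp only [weightedOperator]
  ring

lemma not_ae_witness_nonneg (hδ : 0 < δ) :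
    ¬ ∀ᵐ x ∂(riemannianMeasure (modelMetric hδ)), 0 ≤ witness δ x := by
  intro h
  rw [riemannianMeasure, ae_withDensity_iff (measurable_volDensity hδ).ennreal_ofReal] at h
  have hopen : IsOpen {x : Plane | witness δ x < 0} :=
    isOpen_lt (continuous_witness hδ) continuous_const
  have hne : {x : Plane | witness δ x < 0}.Nonempty := by
    obtain ⟨x, hx⟩ := NormedSpace.exists_lt_norm ℝ Plane (radius δ)
    refine ⟨x, ?_⟩
    have h1 := expGap_pos hδ (pow_lt_pow_left₀ hx (radius_pos hδ).le two_ne_zero)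
    rw [mem_ofPred_eq, witness_eq hδ, neg_lt_zero]
    exact lt_max_of_lt_left h1
  -- The density is everywhere positive, so a nonempty open set cannot be null for the Riemannian
  -- measure.
  refine (hopen.measure_pos volume hne).ne' (measure_mono_null (fun x hx => ?_) h)
  have h2 : ENNReal.ofReal (volDensity (modelMetric hδ) x) ≠ 0 :=
    (ENNReal.ofReal_pos.2 (volDensity_modelMetric_pos hδ x)).ne'
  exact fun hx' => (not_le.2 hx) (hx' h2)

end DistributionalInequality

end ModelSurface

end

theorem theoremB (ε : ℝ) (hε : 0 < ε) :
    ∃ (σ : ℝ → ℝ) (g : ModelSurface.PlaneMetric),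
      -- the model manifold `ℝ₊ ×_σ 𝕊¹`, with the parameter `δ = ε / 4`
      ModelSurface.IsModelMetric g σ ∧
      (∀ t : ℝ, 0 < t → t < 1 / 4 → σ t = t) ∧
      (∀ t : ℝ, ModelSurface.radius (ε / 4) < t →
        σ t = Real.exp (-t ^ (2 + 2 * (ε / 4))) / t ^ (1 + ε / 4)) ∧
      -- the radial coordinate is the Riemannian distance from the pole
      (∀ x : ModelSurface.Plane,
        ModelSurface.riemannianDist g 0 x = ENNReal.ofReal ‖x‖) ∧
      -- `K(x) ∼ -C r(x)^(2 + ε)` at infinity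
      (∃ C : ℝ, 0 < C ∧
        Asymptotics.IsEquivalent (Filter.cocompact ModelSurface.Plane)
          (ModelSurface.gaussianCurvature g)
          (fun x => -C * (ModelSurface.riemannianDist g 0 x).toReal ^ (2 + ε))) ∧
      -- the witness: `V ∈ L¹`, `(-Δ + 1) V ≥ 0`, but not `V ≥ 0` a.e.
      MeasureTheory.MemLp (ModelSurface.witness (ε / 4)) 1
        (ModelSurface.riemannianMeasure g) ∧
      ModelSurface.DistribNonneg g (ModelSurface.witness (ε / 4)) ∧
      (¬ ∀ᵐ x ∂(ModelSurface.riemannianMeasure g), 0 ≤ ModelSurface.witness (ε / 4) x) ∧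
      -- the `L¹`-positivity preserving property fails
      ¬ ModelSurface.PositivityPreserving g 1 := by
  have hδ : 0 < ε / 4 := by positivity
  refine ⟨ModelSurface.warping (ε / 4), ModelSurface.modelMetric hδ,
    ModelSurface.isModelMetric_modelMetric hδ, fun t => ModelSurface.warping_of_lt hδ,
    fun t => ModelSurface.warping_of_gt hδ, ModelSurface.riemannianDist_radialMetric _ _,
    ⟨4 * (1 + ε / 4) ^ 2, by positivity, ?_⟩, memLp_one_iff_integrable.2
    (ModelSurface.integrable_witness hδ), ModelSurface.distribNonneg_witness hδ,
    ModelSurface.not_ae_witness_nonneg hδ, fun h => ModelSurface.not_ae_witness_nonneg hδ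
      (h _ (memLp_one_iff_integrable.2 (ModelSurface.integrable_witness hδ))
        (ModelSurface.distribNonneg_witness hδ))⟩
  have h := ModelSurface.isEquivalent_gaussianCurvature hδ
  have hd : ∀ x : ModelSurface.Plane,
      ModelSurface.riemannianDist (ModelSurface.modelMetric hδ) 0 x = ENNReal.ofReal ‖x‖ :=
    ModelSurface.riemannianDist_radialMetric _ _
  simpa only [hd, ENNReal.toReal_ofReal (norm_nonneg _),
    show 2 + 4 * (ε / 4) = 2 + ε by ring] using h
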